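/- Let $d\ge 1$, $d_x,d_y\ge 0$, $m\ge 1$ be integers. Let $\mathcal X\subset\mathbb R^{d_x}$ satisfy $\|x\|\le B$ for all $x\in\mathcal X$, let $\mathcal Y\subset\mathbb R^{d_y}$, and let $L:\mathcal Y\times\mathcal Y\to\mathbb R^{\ge 0}$ be a measurable loss function such that, for some $M>0$ and $L_r>0$, $L(y,y')\le M$ for all $y,y'\in\mathcal Y$, and $y\mapsto L(y,y')$ is $L_r$-Lipschitz on $\mathcal Y$ for every $y'\in\mathcal Y$ (all vector norms are Euclidean). Fix sizes $m_i\times n_i$ ($1\le i\le d$) with $n_1=d_x$, $n_{i+1}=m_i$, $m_d=1$, and $m_1,\dots,m_{d-1}$ even. Let $\mathcal H^{SD}_d$ be the class of functions $\mathcal X\to\mathbb R$ of the form $$x\mapsto W_d\,\sigma(W_{d-1}\,\sigma(\cdots\sigma(W_1x))),\qquad W_i\in\mathbb R^{m_i\times n_i},\quad \|W_i\|_2=1\ (1\le i\le d),$$ where $\|\cdot\|_2$ is the spectral norm and $\sigma$ is the GroupSort function of group size 2, $\sigma(x_1,x_2,x_3,x_4,\dots)=(\max(x_1,x_2),\min(x_1,x_2),\max(x_3,x_4),\min(x_3,x_4),\dots)$.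 Let $\mathcal H$ be the class of functions $h:\mathcal X\to\mathcal Y$ all of whose components $h_1,\dots,h_{d_y}$ belong to $\mathcal H^{SD}_d$. Let $s_i=(x_i,y_i)$, $i=1,\dots,m$, be i.i.d. samples from a probability distribution $\mathcal D$ on $\mathcal X\times\mathcal Y$. Then for every $\delta\in(0,1)$, with probability at least $1-\delta$ the following holds simultaneously for all $h\in\mathcal H$: $$\mathbb E_{(x,y)\sim\mathcal D}[L(h(x),y)]\le\frac1m\sum_{i=1}^m L(h(x_i),y_i)+\frac{\sqrt2\,d_yL_rB}{\sqrt m}\,2^d\prod_{i=1}^{d-1}\min(m_i,n_i)+3M\sqrt{\frac{\log(1/\delta)}{2m}}.$$ -/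

import Mathlib

open MeasureTheory ProbabilityTheory
open scoped BigOperators

noncomputable section

namespace LCNN

/-- The GroupSort function of group size 2: the (zero-based) coordinates `2j` and `2j + 1`
are replaced by their maximum and minimum; a last unpaired coordinate is left unchanged. -/
def groupSort {k : ℕ} (x : EuclideanSpace ℝ (Fin k)) : EuclideanSpace ℝ (Fin k) :=
  WithLp.toLp 2 fun i : Fin k =>
    if (i : ℕ) % 2 = 0 then
      if h : (i : ℕ) + 1 < k then max (x i) (x ⟨(i : ℕ) + 1, h⟩) else x i
    else
      min (x ⟨(i : ℕ) - 1, lt_of_le_of_lt (Nat.sub_le _ _) i.isLt⟩) (x i)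

section SpectralNorm

open scoped Matrix.Norms.L2Operator

/-- The spectral norm of a real matrix: its operator norm between Euclidean spaces. -/
def specNorm {p q : ℕ} (W : Matrix (Fin p) (Fin q) ℝ) : ℝ := ‖W‖

end SpectralNorm

/-- The output `σ (W_k σ (⋯ σ (W_1 x)))` of the first `k` layers; here `n 0` is the input
dimension, `n i` is the width of layer `i`, and the matrix `W_{i+1}` is `W i`. -/
def hidden {n : ℕ → ℕ} (W : ∀ i : ℕ, Matrix (Fin (n (i + 1))) (Fin (n i)) ℝ) :
    (k : ℕ) → EuclideanSpace ℝ (Fin (n 0)) → EuclideanSpace ℝ (Fin (n k))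
  | 0 => fun x => x
  | k + 1 => fun x => groupSort (Matrix.toEuclideanLin (W k) (hidden W k x))

/-- The class of real-valued networks `x ↦ W_d σ (W_{d-1} σ (⋯ σ (W_1 x)))` of depth `d ≥ 1`
on `X` with layer widths `n`, all of whose weight matrices have spectral norm `1`.
The last matrix `W_d`, which has one row, is `V`. -/
def realClass (n : ℕ → ℕ) (d : ℕ) (X : Set (EuclideanSpace ℝ (Fin (n 0)))) : Set (X → ℝ) :=
  {f | ∃ (W : ∀ i : ℕ, Matrix (Fin (n (i + 1))) (Fin (n i)) ℝ)
      (V : Matrix (Fin 1) (Fin (n (d - 1))) ℝ),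
      (∀ i < d - 1, specNorm (W i) = 1) ∧ specNorm V = 1 ∧
      ∀ x : X, f x = Matrix.toEuclideanLin V (hidden W (d - 1) (x : EuclideanSpace ℝ (Fin (n 0)))) 0}

/-- The class of functions `X → Y ⊆ ℝ^{dy}`, each component of which lies in `realClass`. -/
def vectorClass (n : ℕ → ℕ) (d : ℕ) {dy : ℕ} (X : Set (EuclideanSpace ℝ (Fin (n 0))))
    (Y : Set (EuclideanSpace ℝ (Fin dy))) : Set (X → Y) :=
  {h | ∀ k : Fin dy, (fun x : X => (h x : EuclideanSpace ℝ (Fin dy)) k) ∈ realClass n d X}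

/-- The generalization error of `h` for the loss `L` and the distribution `D`. -/
def generalizationError {X Y : Type*} [MeasurableSpace X] [MeasurableSpace Y]
    (L : Y → Y → ℝ) (D : Measure (X × Y)) (h : X → Y) : ℝ :=
  ∫ z, L (h z.1) z.2 ∂D

/-- The empirical error of `h` on the data set `S`. -/
def empiricalError {X Y : Type*} {m : ℕ} (L : Y → Y → ℝ) (S : Fin m → X × Y) (h : X → Y) : ℝ :=
  (1 / (m : ℝ)) * ∑ i, L (h (S i).1) (S i).2

end LCNN

end

open MeasureTheory ProbabilityTheory
open scoped BigOperators

/-! The bound is a Rademacher estimate. For losses with values in `[0, M]` whose Rademacher sums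
average at most `R` on every sample, the supremum of the summed deviations exceeds `2 * R + τ` with
probability at most `exp (-τ² / (2mM²))`. The exponential moment is bounded directly: Jensen's
inequality brings in a ghost sample, exchanging paired sample points brings in random signs, and
`expect_exp_le` gives concentration on the cube. Suprema are taken over finite families only; a
monotone limit and a dense sequence of weights then reach the whole class, because both sides are
continuous in the weights.

To find `R`, `contraction` replaces the Lipschitz loss by the components of the network, each with
its own signs; the optimal constant in `khintchine` yields the factor `√2`. For one component, the
maximum and minimum of a pair are half its sum plus or minus half its absolute difference. Hence a
functional of norm at most 1 of a GroupSort layer is such a functional of the layer before, plus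
absolute values of such functionals with coefficients of total size at most `√μ`, where `μ = min(p,
q)` for a `p × q` weight matrix (`groupSort_decomposition`). Scalar contraction removes the inner
absolute values and the outer one costs a factor 2, so a bound `C` becomes `C * (1 + 2√μ)`, which is
at most `2μC` once `μ ≥ 2`. As hidden widths are even, `μ = 1` occurs only for one-dimensional
input, where a direct computation gives the same factor. The `d - 1` hidden layers give `2 ^ (d -
1)`, and symmetrization the last 2. -/

namespace LCNN

/-! ### Averages over the discrete cube -/

/-- The sign `±1` attached to a Boolean. -/
def sgn (b : Bool) : ℝ := if b then 1 else -1

@[simp] lemma sgn_true : sgn true = 1 := rfl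

@[simp] lemma sgn_false : sgn false = -1 := rfl

@[simp] lemma sgn_not (b : Bool) : sgn (!b) = -sgn b := by cases b <;> simp

@[simp] lemma abs_sgn (b : Bool) : |sgn b| = 1 := by cases b <;> simp

lemma expect_bool (f : Bool → ℝ) : 𝔼 b, f b = (f true + f false) / 2 := by
  rw [Fintype.expect_eq_sum_div_card, Fintype.sum_bool, Fintype.card_bool, Nat.cast_ofNat]

lemma expect_mono {ι : Type*} [Fintype ι] {f g : ι → ℝ} (h : ∀ i, f i ≤ g i) :
    𝔼 i, f i ≤ 𝔼 i, g i :=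
  Finset.expect_le_expect fun i _ => h i

lemma expect_fin_cons {α : Type*} [Fintype α] {n : ℕ} (f : (Fin (n + 1) → α) → ℝ) :
    𝔼 ε, f ε = 𝔼 a, 𝔼 ε : Fin n → α, f (Fin.cons a ε) := by
  rw [← Finset.expect_product', Finset.univ_product_univ]
  exact (Fintype.expect_equiv (Fin.consEquiv fun _ => α) _ _ fun _ => rfl).symm

lemma expect_cube_succ {n : ℕ} (f : (Fin (n + 1) → Bool) → ℝ) :
    𝔼 ε, f ε = 𝔼 ε : Fin n → Bool, (f (Fin.cons true ε) + f (Fin.cons false ε)) / 2 := by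
  rw [expect_fin_cons, expect_bool, ← Finset.expect_add_distrib, Finset.expect_div]

/-- The antipodal map of the cube. -/
def antipode (ι : Type*) : (ι → Bool) ≃ (ι → Bool) := Equiv.piCongrRight fun _ => Equiv.boolNot

@[simp] lemma antipode_apply {ι : Type*} (ε : ι → Bool) (i : ι) : antipode ι ε i = !ε i := rfl

lemma expect_antipode {ι : Type*} [Fintype ι] [DecidableEq ι] (f : (ι → Bool) → ℝ) :
    𝔼 ε, f (antipode ι ε) = 𝔼 ε, f ε :=
  Fintype.expect_equiv (antipode ι) _ _ fun _ => rfl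

/-- The point of the cube with the coordinate `i` flipped. -/
def flipAt {n : ℕ} (ε : Fin n → Bool) (i : Fin n) : Fin n → Bool := Function.update ε i (!ε i)

@[simp] lemma flipAt_cons_zero {n : ℕ} (b : Bool) (ε : Fin n → Bool) :
    flipAt (Fin.cons b ε : Fin (n + 1) → Bool) 0 = Fin.cons (!b) ε := by
  simp [flipAt, Fin.update_cons_zero]

@[simp] lemma flipAt_cons_succ {n : ℕ} (b : Bool) (ε : Fin n → Bool) (i : Fin n) :
    flipAt (Fin.cons b ε : Fin (n + 1) → Bool) i.succ = Fin.cons b (flipAt ε i) := by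
  simp [flipAt, Fin.cons_update]

/-- The signs are orthonormal: averaging over the first one cancels the cross term. -/
lemma expect_norm_sq_sum {E : Type*} [NormedAddCommGroup E] [InnerProductSpace ℝ E] {n : ℕ}
    (v : Fin n → E) : 𝔼 ε : Fin n → Bool, ‖∑ i, sgn (ε i) • v i‖ ^ 2 = ∑ i, ‖v i‖ ^ 2 := by
  induction n with
  | zero => simp
  | succ n ih =>
    rw [expect_cube_succ, Fin.sum_univ_succ, ← ih fun i => v i.succ]
    simp only [Fin.sum_univ_succ, Fin.cons_zero, Fin.cons_succ, sgn_true, sgn_false, one_smul,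
      neg_smul]
    rw [← Fintype.expect_const (ι := Fin n → Bool) (‖v 0‖ ^ 2), ← Finset.expect_add_distrib]
    refine Finset.expect_congr rfl fun ε _ => ?_
    rw [norm_add_sq_real, norm_add_sq_real, inner_neg_left, norm_neg]
    ring

lemma expect_norm_sum_le {E : Type*} [NormedAddCommGroup E] [InnerProductSpace ℝ E] {n : ℕ}
    (v : Fin n → E) {B : ℝ} (hv : ∀ i, ‖v i‖ ≤ B) :
    𝔼 ε : Fin n → Bool, ‖∑ i, sgn (ε i) • v i‖ ≤ B * √n := by
  rcases n.eq_zero_or_pos with rfl | hn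
  · simp
  have hB : 0 ≤ B := (norm_nonneg _).trans (hv ⟨0, hn⟩)
  refine abs_le_of_sq_le_sq' ?_ (by positivity) |>.2
  have h1 := Finset.expect_mul_sq_le_sq_mul_sq Finset.univ
    (fun ε : Fin n → Bool => ‖∑ i, sgn (ε i) • v i‖) (fun _ => (1 : ℝ))
  simp only [mul_one, one_pow, Fintype.expect_const, expect_norm_sq_sum] at h1
  refine h1.trans ?_
  rw [mul_pow, Real.sq_sqrt (Nat.cast_nonneg n)]
  calc ∑ i, ‖v i‖ ^ 2 ≤ ∑ _i : Fin n, B ^ 2 :=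
        Finset.sum_le_sum fun i _ => pow_le_pow_left₀ (norm_nonneg _) (hv i) 2
    _ = B ^ 2 * n := by simp [mul_comm]

/-- Concentration of functions with bounded differences on the cube. -/
lemma expect_exp_le {n : ℕ} (f : (Fin n → Bool) → ℝ) {c : ℝ}
    (hf : ∀ ε i, |f ε - f (flipAt ε i)| ≤ c) :
    𝔼 ε, Real.exp (f ε) ≤ Real.exp (𝔼 ε, f ε + n * c ^ 2 / 8) := by
  induction n with
  | zero => simp
  | succ n ih =>
    -- Averaging over the first sign preserves the bounded differences, so the induction applies to
    -- `g`.
    set g : (Fin n → Bool) → ℝ := fun ε => (f (Fin.cons true ε) + f (Fin.cons false ε)) / 2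
    have hg : ∀ ε i, |g ε - g (flipAt ε i)| ≤ c := fun ε i => by
      have h1 := hf (Fin.cons true ε) i.succ
      have h2 := hf (Fin.cons false ε) i.succ
      simp only [flipAt_cons_succ] at h1 h2
      rw [abs_le] at *
      constructor <;> simp only [g] <;> linarith [h1.1, h1.2, h2.1, h2.2]
    have hpt : ∀ ε, (Real.exp (f (Fin.cons true ε)) + Real.exp (f (Fin.cons false ε))) / 2
        ≤ Real.exp (c ^ 2 / 8) * Real.exp (g ε) := fun ε => by
      have h0 := hf (Fin.cons true ε) 0
      simp only [flipAt_cons_zero, Bool.not_true] at h0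
      set a := f (Fin.cons true ε)
      set b := f (Fin.cons false ε)
      have e : (Real.exp a + Real.exp b) / 2 = Real.cosh ((a - b) / 2) * Real.exp (g ε) := by
        rw [Real.cosh_eq, div_mul_eq_mul_div, add_mul, ← Real.exp_add, ← Real.exp_add]
        congr 3 <;> simp only [g, a, b] <;> ring
      rw [e]
      -- `cosh x ≤ exp (x² / 2)` at `x = (a - b) / 2` produces the constant `c² / 8`.
      refine mul_le_mul_of_nonneg_right ((Real.cosh_le_exp_half_sq _).trans ?_)
        (Real.exp_pos _).le
      rw [Real.exp_le_exp]
      have := sq_le_sq' (abs_le.1 h0).1 (abs_le.1 h0).2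
      linarith
    rw [expect_cube_succ, expect_cube_succ]
    calc _ ≤ 𝔼 ε, Real.exp (c ^ 2 / 8) * Real.exp (g ε) := expect_mono hpt
      _ = Real.exp (c ^ 2 / 8) * 𝔼 ε, Real.exp (g ε) := (Finset.mul_expect ..).symm
      _ ≤ Real.exp (c ^ 2 / 8) * Real.exp (𝔼 ε, g ε + n * c ^ 2 / 8) :=
        mul_le_mul_of_nonneg_left (ih g hg) (Real.exp_pos _).le
      _ = _ := by
        rw [← Real.exp_add]
        congr 1
        push_cast
        ring

/-! ### The Poincaré and Khintchine inequalities -/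

/-- The number operator of the cube. -/
noncomputable def cubeLaplacian {n : ℕ} (f : (Fin n → Bool) → ℝ) (ε : Fin n → Bool) : ℝ :=
  ∑ i, (f ε - f (flipAt ε i)) / 2

lemma cubeLaplacian_add {n : ℕ} (f g : (Fin n → Bool) → ℝ) (ε : Fin n → Bool) :
    cubeLaplacian (fun ε => f ε + g ε) ε = cubeLaplacian f ε + cubeLaplacian g ε := by
  simp only [cubeLaplacian, ← Finset.sum_add_distrib]
  exact Finset.sum_congr rfl fun _ _ => by ring

lemma cubeLaplacian_sub {n : ℕ} (f g : (Fin n → Bool) → ℝ) (ε : Fin n → Bool) :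
    cubeLaplacian (fun ε => f ε - g ε) ε = cubeLaplacian f ε - cubeLaplacian g ε := by
  simp only [cubeLaplacian, ← Finset.sum_sub_distrib]
  exact Finset.sum_congr rfl fun _ _ => by ring

/-- Writing `f = g + ε₀ h` drives the inductions below; it replaces the Walsh expansion. -/
lemma exists_cube_decomposition {n : ℕ} (f : (Fin (n + 1) → Bool) → ℝ) :
    ∃ g h : (Fin n → Bool) → ℝ, (∀ ε, f (Fin.cons true ε) = g ε + h ε) ∧
      ∀ ε, f (Fin.cons false ε) = g ε - h ε :=
  ⟨fun ε => (f (Fin.cons true ε) + f (Fin.cons false ε)) / 2,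
    fun ε => (f (Fin.cons true ε) - f (Fin.cons false ε)) / 2,
    fun _ => by ring, fun _ => by ring⟩

section

variable {n : ℕ} {f : (Fin (n + 1) → Bool) → ℝ} {g h : (Fin n → Bool) → ℝ}

lemma expect_decomposition (ht : ∀ ε, f (Fin.cons true ε) = g ε + h ε)
    (hf : ∀ ε, f (Fin.cons false ε) = g ε - h ε) : 𝔼 ε, f ε = 𝔼 ε, g ε := by
  rw [expect_cube_succ]
  exact Finset.expect_congr rfl fun ε _ => by rw [ht, hf]; ring

lemma expect_sq_decomposition (ht : ∀ ε, f (Fin.cons true ε) = g ε + h ε)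
    (hf : ∀ ε, f (Fin.cons false ε) = g ε - h ε) :
    𝔼 ε, f ε ^ 2 = 𝔼 ε, g ε ^ 2 + 𝔼 ε, h ε ^ 2 := by
  rw [expect_cube_succ, ← Finset.expect_add_distrib]
  exact Finset.expect_congr rfl fun ε _ => by rw [ht, hf]; ring

/-- The number operator sends `ε₀ h` to `ε₀ (N h + h)`, and terms odd in `ε₀` average to zero. -/
lemma expect_mul_cubeLaplacian_decomposition (ht : ∀ ε, f (Fin.cons true ε) = g ε + h ε)
    (hf : ∀ ε, f (Fin.cons false ε) = g ε - h ε) :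
    𝔼 ε, f ε * cubeLaplacian f ε =
      𝔼 ε, g ε * cubeLaplacian g ε + 𝔼 ε, h ε * cubeLaplacian h ε + 𝔼 ε, h ε ^ 2 := by
  rw [expect_cube_succ, ← Finset.expect_add_distrib, ← Finset.expect_add_distrib]
  refine Finset.expect_congr rfl fun ε _ => ?_
  have h1 : cubeLaplacian f (Fin.cons true ε) =
      h ε + (cubeLaplacian g ε + cubeLaplacian h ε) := by
    rw [← cubeLaplacian_add, cubeLaplacian, Fin.sum_univ_succ]
    simp only [flipAt_cons_zero, flipAt_cons_succ, ht, hf, Bool.not_true, cubeLaplacian]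
    ring
  have h2 : cubeLaplacian f (Fin.cons false ε) =
      -h ε + (cubeLaplacian g ε - cubeLaplacian h ε) := by
    rw [← cubeLaplacian_sub, cubeLaplacian, Fin.sum_univ_succ]
    simp only [flipAt_cons_zero, flipAt_cons_succ, ht, hf, Bool.not_false, cubeLaplacian]
    ring
  rw [h1, h2, ht, hf]
  ring

end

/-- The Poincaré inequality on the cube. -/
lemma cube_poincare {n : ℕ} (f : (Fin n → Bool) → ℝ) :
    𝔼 ε, f ε ^ 2 - (𝔼 ε, f ε) ^ 2 ≤ 𝔼 ε, f ε * cubeLaplacian f ε := by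
  induction n with
  | zero => simp [cubeLaplacian]
  | succ n ih =>
    obtain ⟨g, h, ht, hf⟩ := exists_cube_decomposition f
    rw [expect_decomposition ht hf, expect_sq_decomposition ht hf,
      expect_mul_cubeLaplacian_decomposition ht hf]
    -- The form dominates a variance by induction, hence is nonnegative.
    have h0 : 0 ≤ 𝔼 ε, h ε * cubeLaplacian h ε := by
      refine le_trans ?_ (ih h)
      have := Finset.expect_mul_sq_le_sq_mul_sq Finset.univ h (fun _ => (1 : ℝ))
      simp only [mul_one, one_pow, Fintype.expect_const] at this
      linarith
    linarith [ih g]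

/-- A Poincaré inequality with spectral gap `2` up to the first order coefficients. -/
lemma cube_poincare_second {n : ℕ} (f : (Fin n → Bool) → ℝ) :
    2 * (𝔼 ε, f ε ^ 2 - (𝔼 ε, f ε) ^ 2) - ∑ i, (𝔼 ε, sgn (ε i) * f ε) ^ 2 ≤
      𝔼 ε, f ε * cubeLaplacian f ε := by
  induction n with
  | zero => simp [cubeLaplacian]
  | succ n ih =>
    obtain ⟨g, h, ht, hf⟩ := exists_cube_decomposition f
    have h0 : 𝔼 ε, sgn (ε 0) * f ε = 𝔼 ε, h ε := by
      rw [expect_cube_succ]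
      exact Finset.expect_congr rfl fun ε _ => by simp [ht, hf]; ring
    have hs : ∀ i : Fin n, 𝔼 ε, sgn (ε i.succ) * f ε = 𝔼 ε, sgn (ε i) * g ε := fun i => by
      rw [expect_cube_succ]
      exact Finset.expect_congr rfl fun ε _ => by simp only [Fin.cons_succ, ht, hf]; ring
    rw [expect_decomposition ht hf, expect_sq_decomposition ht hf,
      expect_mul_cubeLaplacian_decomposition ht hf, Fin.sum_univ_succ, h0]
    simp only [hs]
    -- The new first-order coefficient is the mean of `h`, so the `h` part is exactly the ordinary
    -- Poincaré inequality.
    linarith [ih g, cube_poincare h]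

/-- The Khintchine inequality with the optimal constant. -/
lemma khintchine {n : ℕ} (a : Fin n → ℝ) :
    √(∑ i, a i ^ 2) ≤ √2 * 𝔼 ε : Fin n → Bool, |∑ i, sgn (ε i) * a i| := by
  set f : (Fin n → Bool) → ℝ := fun ε => |∑ i, sgn (ε i) * a i|
  have hsq : 𝔼 ε, f ε ^ 2 = ∑ i, a i ^ 2 := by
    simpa [f] using expect_norm_sq_sum a
  -- `f` is even, so all its first-order coefficients vanish and the gap 2 is available.
  have hodd : ∀ i, 𝔼 ε, sgn (ε i) * f ε = 0 := fun i => by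
    have h := expect_antipode fun ε : Fin n → Bool => sgn (ε i) * f ε
    simp only [f, antipode_apply, sgn_not, neg_mul, Finset.sum_neg_distrib, abs_neg,
      Finset.expect_neg_distrib] at h
    simp only [f]
    linarith
  -- With `S` the signed sum, the triangle inequality over the `n` flips gives a total of at least
  -- `|(n - 2) S|`. Then `2 (E f² - (E f)²) ≤ E f²`, which is the claim.
  have hlap : ∀ ε, cubeLaplacian f ε ≤ f ε := fun ε => by
    have hflip : ∀ i, f (flipAt ε i) = |∑ j, sgn (ε j) * a j - 2 * (sgn (ε i) * a i)| := fun i => by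
      simp only [f]
      congr 1
      rw [← Finset.add_sum_erase _ _ (Finset.mem_univ i),
        ← Finset.add_sum_erase (a := i) _ (fun j => sgn (ε j) * a j) (Finset.mem_univ i),
        Finset.sum_congr rfl fun j hj => by
          rw [flipAt, Function.update_of_ne (Finset.ne_of_mem_erase hj)]]
      simp only [flipAt, Function.update_self, sgn_not]
      ring
    have h1 : |∑ i, (∑ j, sgn (ε j) * a j - 2 * (sgn (ε i) * a i))| ≤ ∑ i, f (flipAt ε i) := by
      simp only [hflip]
      exact Finset.abs_sum_le_sum_abs _ _
    have h2 : ∑ i, (∑ j, sgn (ε j) * a j - 2 * (sgn (ε i) * a i)) =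
        (n - 2 : ℝ) * ∑ j, sgn (ε j) * a j := by
      rw [Finset.sum_sub_distrib, ← Finset.mul_sum]
      simp
      ring
    rw [h2, abs_mul] at h1
    have h3 : (n - 2 : ℝ) * f ε ≤ ∑ i, f (flipAt ε i) :=
      (mul_le_mul_of_nonneg_right (le_abs_self _) (abs_nonneg _)).trans h1
    rw [cubeLaplacian, ← Finset.sum_div, Finset.sum_sub_distrib]
    simp only [Finset.sum_const, Finset.card_univ, Fintype.card_fin, nsmul_eq_mul]
    linarith
  have hle : 𝔼 ε, f ε * cubeLaplacian f ε ≤ 𝔼 ε, f ε ^ 2 :=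
    expect_mono fun ε => by
      rw [sq]
      exact mul_le_mul_of_nonneg_left (hlap ε) (abs_nonneg _)
  have key := cube_poincare_second f
  simp only [hodd] at key
  have hpos : 0 ≤ 𝔼 ε, f ε := Finset.expect_nonneg fun _ _ => abs_nonneg _
  rw [← hsq]
  refine Real.sqrt_le_iff.2 ⟨by positivity, ?_⟩
  rw [mul_pow, Real.sq_sqrt zero_le_two]
  simp at key
  linarith

/-! ### Contraction of Rademacher averages -/

/-- For each `η`, the better of the two points is chosen. Allotting the two points to `η` and its
antipode in the better order gains the absolute value, whose average dominates the increment of `ψ`.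
-/
lemma contraction_step {T : Type*} {K : ℕ} (G ψ : T → ℝ) (φ : Fin K → T → ℝ)
    (h : ∀ t t', |ψ t - ψ t'| ≤
      𝔼 η : Fin K → Bool, |∑ k, sgn (η k) * (φ k t - φ k t')|) (t : Bool → T) :
    ∃ t' : (Fin K → Bool) → T, 𝔼 b, (G (t b) + sgn b * ψ (t b)) ≤
      𝔼 η, (G (t' η) + ∑ k, sgn (η k) * φ k (t' η)) := by
  set H : (Fin K → Bool) → T → ℝ := fun η u => G u + ∑ k, sgn (η k) * φ k u
  set t' : (Fin K → Bool) → T := fun η =>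
    if H η (t false) ≤ H η (t true) then t true else t false
  have hmax : ∀ η b, H η (t b) ≤ H η (t' η) := fun η b => by
    simp only [t']
    split_ifs with hle <;> cases b <;> simp_all [le_of_lt]
  refine ⟨t', ?_⟩
  have hanti := expect_antipode fun η => H η (t' η)
  have hpt : ∀ η, G (t true) + G (t false) +
      |∑ k, sgn (η k) * (φ k (t true) - φ k (t false))| ≤
        H η (t' η) + H (antipode _ η) (t' (antipode _ η)) := fun η => by
    have e : ∀ u, H (antipode _ η) u = G u - ∑ k, sgn (η k) * φ k u := fun u => by
      simp [H, sub_eq_add_neg]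
    have e' : ∀ u, H η u = G u + ∑ k, sgn (η k) * φ k u := fun u => rfl
    have h1 := hmax η true
    have h2 := hmax η false
    have h3 := hmax (antipode _ η) true
    have h4 := hmax (antipode _ η) false
    simp only [mul_sub, Finset.sum_sub_distrib]
    rw [e] at h3 h4
    rw [e'] at h1 h2
    rcases abs_cases (∑ k, sgn (η k) * φ k (t true) - ∑ k, sgn (η k) * φ k (t false)) with hc | hc
      <;> linarith [hc.1]
  have hsum := expect_mono hpt
  simp only [Finset.expect_add_distrib, Fintype.expect_const, hanti] at hsum
  have h1 := h (t true) (t false)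
  have h2 := le_abs_self (ψ (t true) - ψ (t false))
  rw [expect_bool]
  simp only [sgn_true, sgn_false]
  change _ ≤ 𝔼 η, H η (t' η)
  linarith

/-- Vector-valued contraction principle, stated for choice functions instead of suprema. -/
lemma contraction {T : Type*} {K m : ℕ} (G : T → ℝ) (ψ : Fin m → T → ℝ)
    (φ : Fin m → Fin K → T → ℝ)
    (h : ∀ i t t', |ψ i t - ψ i t'| ≤
      𝔼 η : Fin K → Bool, |∑ k, sgn (η k) * (φ i k t - φ i k t')|)
    (t : (Fin m → Bool) → T) :
    ∃ t' : (Fin m → Fin K → Bool) → T, 𝔼 ε, (G (t ε) + ∑ i, sgn (ε i) * ψ i (t ε)) ≤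
      𝔼 η, (G (t' η) + ∑ i, ∑ k, sgn (η i k) * φ i k (t' η)) := by
  induction m generalizing G with
  | zero =>
    refine ⟨fun _ => t default, ?_⟩
    simp only [Finset.univ_eq_empty, Finset.sum_empty, add_zero, Fintype.expect_const]
    rw [Fintype.expect_eq_sum_div_card, Fintype.sum_unique]
    simp only [Fintype.card_unique, Nat.cast_one, div_one]
    exact (congrArg (fun e => G (t e)) (Subsingleton.elim _ _)).le
  | succ m ih =>
    -- The function `G` absorbs all other signed terms, so that one sign is exchanged at a time.
    have hstep := fun ε : Fin m → Bool => contraction_step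
      (fun u => G u + ∑ i, sgn (ε i) * ψ i.succ u) (ψ 0) (φ 0) (h 0) (fun b => t (Fin.cons b ε))
    choose t₁ ht₁ using hstep
    have hih := fun η : Fin K → Bool => ih (fun u => G u + ∑ k, sgn (η k) * φ 0 k u)
      (fun i => ψ i.succ) (fun i => φ i.succ) (fun i => h i.succ) (fun ε => t₁ ε η)
    choose t₂ ht₂ using hih
    refine ⟨fun η => t₂ (η 0) (Fin.tail η), ?_⟩
    rw [expect_fin_cons, expect_fin_cons, Finset.expect_comm]
    simp only [Fin.sum_univ_succ, Fin.cons_zero, Fin.cons_succ, Fin.tail_cons]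
    calc _ = 𝔼 ε : Fin m → Bool, 𝔼 b, ((G (t (Fin.cons b ε)) +
            ∑ i, sgn (ε i) * ψ i.succ (t (Fin.cons b ε))) +
            sgn b * ψ 0 (t (Fin.cons b ε))) :=
          Finset.expect_congr rfl fun _ _ => Finset.expect_congr rfl fun _ _ => by ring
      _ ≤ _ := expect_mono ht₁
      _ = _ := Finset.expect_comm ..
      _ = 𝔼 η : Fin K → Bool, 𝔼 ε : Fin m → Bool, ((G (t₁ ε η) +
            ∑ k, sgn (η k) * φ 0 k (t₁ ε η)) + ∑ i, sgn (ε i) * ψ i.succ (t₁ ε η)) :=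
          Finset.expect_congr rfl fun _ _ => Finset.expect_congr rfl fun _ _ => by ring
      _ ≤ _ := expect_mono ht₂
      _ = _ :=
          Finset.expect_congr rfl fun _ _ => Finset.expect_congr rfl fun _ _ => by ring
/-! ### Weight matrices -/

/-- The `j`-th row of a matrix as a Euclidean vector. -/
noncomputable def rowVec {p q : ℕ} (W : Matrix (Fin p) (Fin q) ℝ) (j : Fin p) :
    EuclideanSpace ℝ (Fin q) :=
  WithLp.toLp 2 (W j)

lemma euclidean_inner {p : ℕ} (u v : EuclideanSpace ℝ (Fin p)) :
    inner ℝ u v = ∑ j, u j * v j := by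
  simp [PiLp.inner_apply, mul_comm]

lemma toEuclideanLin_apply_eq_inner {p q : ℕ} (W : Matrix (Fin p) (Fin q) ℝ)
    (z : EuclideanSpace ℝ (Fin q)) (j : Fin p) :
    Matrix.toEuclideanLin W z j = inner ℝ (rowVec W j) z := by
  rw [euclidean_inner]
  simp [rowVec, Matrix.toLpLin_apply, Matrix.mulVec, dotProduct]

section

open scoped Matrix.Norms.L2Operator

lemma norm_toEuclideanLin_le {p q : ℕ} (W : Matrix (Fin p) (Fin q) ℝ)
    (z : EuclideanSpace ℝ (Fin q)) : ‖Matrix.toEuclideanLin W z‖ ≤ specNorm W * ‖z‖ :=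
  Matrix.l2_opNorm_mulVec W z

lemma pos_of_specNorm_eq_one {p q : ℕ} {W : Matrix (Fin p) (Fin q) ℝ} (hW : specNorm W = 1) :
    0 < p ∧ 0 < q := by
  have hne : W ≠ 0 := by
    rintro rfl
    simp [specNorm] at hW
  constructor
  · refine Nat.pos_of_ne_zero ?_
    rintro rfl
    exact hne (Subsingleton.elim _ _)
  · refine Nat.pos_of_ne_zero ?_
    rintro rfl
    exact hne (Subsingleton.elim _ _)

end

lemma norm_toEuclideanLin_le_of_specNorm {p q : ℕ} {W : Matrix (Fin p) (Fin q) ℝ}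
    (hW : specNorm W = 1) (z : EuclideanSpace ℝ (Fin q)) :
    ‖Matrix.toEuclideanLin W z‖ ≤ ‖z‖ := by
  simpa [hW] using norm_toEuclideanLin_le W z

/-- The transpose of a matrix of spectral norm `1` is a contraction. -/
lemma exists_adjoint_vector {p q : ℕ} {W : Matrix (Fin p) (Fin q) ℝ} (hW : specNorm W = 1)
    (u : EuclideanSpace ℝ (Fin p)) : ∃ v : EuclideanSpace ℝ (Fin q), ‖v‖ ≤ ‖u‖ ∧
      ∀ z, inner ℝ u (Matrix.toEuclideanLin W z) = inner ℝ v z := by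
  have key : ∀ z, inner ℝ u (Matrix.toEuclideanLin W z) =
      inner ℝ ((Matrix.toEuclideanLin W).adjoint u) z := fun z =>
    (LinearMap.adjoint_inner_left _ _ _).symm
  refine ⟨(Matrix.toEuclideanLin W).adjoint u, ?_, key⟩
  set v := (Matrix.toEuclideanLin W).adjoint u
  have h : ‖v‖ * ‖v‖ ≤ ‖u‖ * ‖v‖ := by
    rw [← real_inner_self_eq_norm_mul_norm, ← key v]
    exact (real_inner_le_norm _ _).trans
      (mul_le_mul_of_nonneg_left (norm_toEuclideanLin_le_of_specNorm hW v) (norm_nonneg _))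
  rcases (norm_nonneg v).eq_or_lt with h0 | h0
  · rw [← h0]
    exact norm_nonneg u
  · exact le_of_mul_le_mul_right h h0

lemma norm_rowVec_le {p q : ℕ} {W : Matrix (Fin p) (Fin q) ℝ} (hW : specNorm W = 1)
    (j : Fin p) : ‖rowVec W j‖ ≤ 1 := by
  obtain ⟨v, hv, h⟩ := exists_adjoint_vector hW (EuclideanSpace.single j (1 : ℝ))
  have e : rowVec W j = v := by
    refine ext_inner_right ℝ fun z => ?_
    rw [← h z, ← toEuclideanLin_apply_eq_inner, euclidean_inner]
    simp
  rw [e]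
  simpa using hv

/-- The squared Frobenius norm is summed by rows or by columns, and each of these has norm at most
1. -/
lemma sum_norm_sq_rowVec_le {p q : ℕ} {W : Matrix (Fin p) (Fin q) ℝ} (hW : specNorm W = 1) :
    ∑ j, ‖rowVec W j‖ ^ 2 ≤ ((min p q : ℕ) : ℝ) := by
  rw [Nat.cast_min, le_min_iff]
  constructor
  · calc ∑ j, ‖rowVec W j‖ ^ 2 ≤ ∑ _j : Fin p, (1 : ℝ) :=
        Finset.sum_le_sum fun j _ => pow_le_one₀ (norm_nonneg _) (norm_rowVec_le hW j)
      _ = p := by simp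
  · have e : ∑ j, ‖rowVec W j‖ ^ 2 =
        ∑ k : Fin q, ‖Matrix.toEuclideanLin W (EuclideanSpace.single k (1 : ℝ))‖ ^ 2 := by
      simp only [EuclideanSpace.norm_sq_eq, toEuclideanLin_apply_eq_inner]
      rw [Finset.sum_comm]
      simp [euclidean_inner]
    rw [e]
    calc _ ≤ ∑ _k : Fin q, (1 : ℝ) := Finset.sum_le_sum fun k _ => by
          refine pow_le_one₀ (norm_nonneg _) ?_
          simpa using norm_toEuclideanLin_le_of_specNorm hW (EuclideanSpace.single k (1 : ℝ))
      _ = q := by simp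

/-! ### GroupSort -/

/-- The index with which `i` is compared by `groupSort`. -/
def partner {p : ℕ} (hp : Even p) (i : Fin p) : Fin p :=
  if h : (i : ℕ) % 2 = 0 then ⟨(i : ℕ) + 1, by
    have := i.isLt
    obtain ⟨r, hr⟩ := hp
    omega⟩
  else ⟨(i : ℕ) - 1, by have := i.isLt; omega⟩

lemma partner_partner {p : ℕ} (hp : Even p) (i : Fin p) : partner hp (partner hp i) = i := by
  ext
  by_cases h : (i : ℕ) % 2 = 0
  · have h' : ¬((i : ℕ) + 1) % 2 = 0 := by omega
    simp [partner, h, h']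
  · have h' : ((i : ℕ) - 1) % 2 = 0 := by omega
    simp only [partner, h, h', dite_true, dite_false]
    omega

/-- `partner` as a permutation. -/
def partnerPerm {p : ℕ} (hp : Even p) : Equiv.Perm (Fin p) :=
  ⟨partner hp, partner hp, partner_partner hp, partner_partner hp⟩

lemma groupSort_apply {p : ℕ} (hp : Even p) (y : EuclideanSpace ℝ (Fin p)) (i : Fin p) :
    groupSort y i = (y i + y (partnerPerm hp i)) / 2 +
      sgn ((i : ℕ) % 2 = 0) * (|y i - y (partnerPerm hp i)| / 2) := by
  have hi := i.isLt
  by_cases h : (i : ℕ) % 2 = 0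
  · have h1 : (i : ℕ) + 1 < p := by
      obtain ⟨r, hr⟩ := hp
      omega
    have e : partnerPerm hp i = ⟨(i : ℕ) + 1, h1⟩ := by
      simp [partnerPerm, partner, h]
    rw [e]
    simp only [groupSort, h, h1, if_true, dite_true, decide_true, sgn_true, one_mul]
    rw [max_def]
    split_ifs with h2
    · rw [abs_of_nonpos (by linarith)]; ring
    · rw [abs_of_nonneg (by linarith)]; ring
  · have e : partnerPerm hp i = ⟨(i : ℕ) - 1, by omega⟩ := by
      simp [partnerPerm, partner, h]
    rw [e]
    simp only [groupSort, h, if_false, decide_false, sgn_false]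
    rw [min_def]
    split_ifs with h2
    · rw [abs_of_nonneg (by linarith)]; ring
    · rw [abs_of_nonpos (by linarith)]; ring

/-- A linear functional of a GroupSort layer is a linear functional of the input plus a
combination of absolute values of linear functionals. -/
lemma groupSort_decomposition {p q : ℕ} (hp : Even p) {W : Matrix (Fin p) (Fin q) ℝ}
    (hW : specNorm W = 1) (u : EuclideanSpace ℝ (Fin p)) (hu : ‖u‖ ≤ 1) :
    ∃ (v : EuclideanSpace ℝ (Fin q)) (c : Fin p → ℝ) (r : Fin p → EuclideanSpace ℝ (Fin q)),
      ‖v‖ ≤ 1 ∧ (∀ j, ‖r j‖ ≤ 1) ∧ ∑ j, |c j| ≤ √((min p q : ℕ) : ℝ) ∧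
      ∀ z, inner ℝ u (groupSort (Matrix.toEuclideanLin W z)) =
        inner ℝ v z + ∑ j, c j * |inner ℝ (r j) z| := by
  set π := partnerPerm hp
  have hππ : ∀ j, π (π j) = j := partner_partner hp
  set u' : EuclideanSpace ℝ (Fin p) := WithLp.toLp 2 fun j => u (π j)
  have hu' : ‖u'‖ ≤ 1 := by
    have : ‖u'‖ = ‖u‖ := by
      rw [EuclideanSpace.norm_eq, EuclideanSpace.norm_eq]
      congr 1
      exact Equiv.sum_comp π fun j => ‖u j‖ ^ 2
    rwa [this]
  -- The half sums of the pairs are symmetric under the pairing, so the linear part sees only the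
  -- pair average of `u`.
  have hubar : ‖(1 / 2 : ℝ) • (u + u')‖ ≤ 1 := by
    rw [norm_smul, Real.norm_of_nonneg (by norm_num)]
    linarith [norm_add_le u u']
  obtain ⟨v, hv, hvz⟩ := exists_adjoint_vector hW ((1 / 2 : ℝ) • (u + u'))
  -- Normalizing the row differences moves their length into the coefficients, which Cauchy-Schwarz
  -- and the Frobenius bound control. If `ρ j = 0`, both the coefficient and the vector are zero.
  set ρ : Fin p → EuclideanSpace ℝ (Fin q) := fun j => rowVec W j - rowVec W (π j)
  refine ⟨v, fun j => u j * sgn ((j : ℕ) % 2 = 0) / 2 * ‖ρ j‖, fun j => ‖ρ j‖⁻¹ • ρ j,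
    hv.trans hubar, fun j => ?_, ?_, fun z => ?_⟩
  · rw [norm_smul, norm_inv, norm_norm]
    exact inv_mul_le_one
  · have hrow := sum_norm_sq_rowVec_le hW
    have hcs : ∀ g : Fin p → ℝ, ∑ j, g j ^ 2 ≤ ((min p q : ℕ) : ℝ) →
        ∑ j, |u j| * g j ≤ √((min p q : ℕ) : ℝ) := fun g hg => by
      refine (Real.sum_mul_le_sqrt_mul_sqrt _ _ _).trans ?_
      have h1 : √(∑ j, |u j| ^ 2) = ‖u‖ := by
        rw [EuclideanSpace.norm_eq]
        rfl
      rw [h1]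
      exact (mul_le_of_le_one_left (Real.sqrt_nonneg _) hu).trans (Real.sqrt_le_sqrt hg)
    have h1 := hcs (fun j => ‖rowVec W j‖) hrow
    have h2 := hcs (fun j => ‖rowVec W (π j)‖)
      ((Equiv.sum_comp π fun j => ‖rowVec W j‖ ^ 2).trans_le hrow)
    calc ∑ j, |u j * sgn ((j : ℕ) % 2 = 0) / 2 * ‖ρ j‖|
        ≤ ∑ j, (|u j| * ‖rowVec W j‖ + |u j| * ‖rowVec W (π j)‖) / 2 :=
          Finset.sum_le_sum fun j _ => by
            rw [abs_mul, abs_div, abs_mul, abs_sgn, mul_one, abs_norm, abs_two, ← mul_add,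
              div_mul_eq_mul_div]
            exact div_le_div_of_nonneg_right
              (mul_le_mul_of_nonneg_left (norm_sub_le _ _) (abs_nonneg _)) zero_le_two
      _ ≤ √((min p q : ℕ) : ℝ) := by
          rw [← Finset.sum_div, Finset.sum_add_distrib]
          linarith
  · rw [← hvz z, euclidean_inner, euclidean_inner]
    set y := Matrix.toEuclideanLin W z with hy
    have habs : ∀ j, u j * sgn ((j : ℕ) % 2 = 0) / 2 * ‖ρ j‖ * |inner ℝ (‖ρ j‖⁻¹ • ρ j) z| =
        u j * (sgn ((j : ℕ) % 2 = 0) * (|y j - y (π j)| / 2)) := fun j => by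
      have e : y j - y (π j) = inner ℝ (ρ j) z := by
        rw [hy, toEuclideanLin_apply_eq_inner, toEuclideanLin_apply_eq_inner, ← inner_sub_left]
      rw [e, real_inner_smul_left, abs_mul, abs_inv, abs_norm]
      rcases eq_or_ne (ρ j) 0 with h0 | h0
      · simp [h0]
      · have := norm_ne_zero_iff.2 h0
        field_simp
    simp only [habs]
    have hlin : ∑ j, u (π j) * y j = ∑ j, u j * y (π j) := by
      rw [← Equiv.sum_comp π]
      simp only [hππ]
    calc ∑ j, u j * groupSort y j = ∑ j, (u j * y j / 2 + u j * y (π j) / 2 +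
          u j * (sgn ((j : ℕ) % 2 = 0) * (|y j - y (π j)| / 2))) :=
          Finset.sum_congr rfl fun j _ => by rw [groupSort_apply hp]; ring
      _ = ∑ j, (u j * y j / 2 + u (π j) * y j / 2 ) +
          ∑ j, u j * (sgn ((j : ℕ) % 2 = 0) * (|y j - y (π j)| / 2)) := by
          rw [Finset.sum_add_distrib, Finset.sum_add_distrib, Finset.sum_add_distrib,
            ← Finset.sum_div, ← Finset.sum_div, ← Finset.sum_div, hlin]
      _ = _ := by
          congr 1
          refine Finset.sum_congr rfl fun j _ => ?_
          simp only [PiLp.smul_apply, PiLp.add_apply, smul_eq_mul, u']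
          ring

/-! ### Rademacher averages -/

/-- The Rademacher average of `F` is at most `C`; the supremum over `F` is expressed by an
arbitrary choice of an element of `F` for every sign vector. -/
def RadLE {m : ℕ} (F : Set (Fin m → ℝ)) (C : ℝ) : Prop :=
  ∀ t : (Fin m → Bool) → Fin m → ℝ, (∀ ε, t ε ∈ F) → 𝔼 ε, ∑ i, sgn (ε i) * t ε i ≤ C

lemma RadLE.mono {m : ℕ} {F : Set (Fin m → ℝ)} {C C' : ℝ} (h : RadLE F C) (hC : C ≤ C') :
    RadLE F C' := fun t ht => (h t ht).trans hC

/-- The absolute value is 1-Lipschitz, so this is contraction with one sign per sample point. -/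
lemma RadLE.abs {m : ℕ} {F : Set (Fin m → ℝ)} {C : ℝ} (h : RadLE F C) :
    RadLE ((fun t i => |t i|) '' F) C := by
  intro t ht
  choose q hqF hq using ht
  obtain ⟨t', ht'⟩ := contraction (T := F) (K := 1) (fun _ => 0) (fun i t => |(t : Fin m → ℝ) i|)
    (fun i _ t => (t : Fin m → ℝ) i) (fun i t t' => by
      rw [Fintype.expect_eq_sum_div_card]
      simp [abs_mul]
      exact abs_abs_sub_abs_le _ _) (fun ε => ⟨q ε, hqF ε⟩)
  simp only [Finset.univ_unique, Finset.sum_singleton, zero_add] at ht'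
  set e : (Fin m → Fin 1 → Bool) ≃ (Fin m → Bool) :=
    Equiv.piCongrRight fun _ => Equiv.funUnique (Fin 1) Bool
  simp only [← hq]
  refine ht'.trans ?_
  refine le_of_eq_of_le (Fintype.expect_equiv e _
    (fun ε => ∑ i, sgn (ε i) * (t' (e.symm ε) : Fin m → ℝ) i) fun η => ?_)
    (h (fun ε => (t' (e.symm ε) : Fin m → ℝ)) fun ε => (t' (e.symm ε)).2)
  rw [Equiv.symm_apply_apply]
  rfl

/-- Positive and negative parts cost `C` each: choosing `0` where the sum has the wrong sign
isolates a part, and the antipode turns the negative part into a positive one. -/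
lemma RadLE.expect_abs_le {m : ℕ} {F : Set (Fin m → ℝ)} {C : ℝ} (h : RadLE F C)
    (h0 : 0 ∈ F) (t : (Fin m → Bool) → Fin m → ℝ) (ht : ∀ ε, t ε ∈ F) :
    𝔼 ε, |∑ i, sgn (ε i) * t ε i| ≤ 2 * C := by
  set S : (Fin m → Bool) → ℝ := fun ε => ∑ i, sgn (ε i) * t ε i
  have h1 := h (fun ε => if 0 ≤ S ε then t ε else 0) fun ε => by
    split_ifs
    exacts [ht ε, h0]
  have h2 := h (fun ε => if 0 ≤ S (antipode _ ε) then 0 else t (antipode _ ε)) fun ε => by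
    split_ifs
    exacts [h0, ht _]
  rw [← expect_antipode] at h2
  have hpt : ∀ ε, |S ε| ≤ ∑ i, sgn (ε i) * (if 0 ≤ S ε then t ε else 0) i +
      ∑ i, sgn (antipode _ ε i) *
        (if 0 ≤ S (antipode _ (antipode _ ε)) then 0 else t (antipode _ (antipode _ ε))) i := by
    intro ε
    have e : antipode _ (antipode _ ε) = ε := by ext i; simp
    rw [e]
    split_ifs with hS
    · rw [abs_of_nonneg hS]
      simp [S]
    · rw [abs_of_neg (not_le.1 hS)]
      simp [S]
  have := expect_mono hpt
  rw [Finset.expect_add_distrib] at this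
  linarith

/-! ### Rademacher averages of GroupSort networks -/

/-- The values at `x` of the linear functionals of norm at most `1` of the `k`-th hidden layer. -/
def hiddenClass (n : ℕ → ℕ) (k : ℕ) {m : ℕ} (x : Fin m → EuclideanSpace ℝ (Fin (n 0))) :
    Set (Fin m → ℝ) :=
  {q | ∃ (W : ∀ i : ℕ, Matrix (Fin (n (i + 1))) (Fin (n i)) ℝ) (u : EuclideanSpace ℝ (Fin (n k))),
    (∀ i < k, specNorm (W i) = 1) ∧ ‖u‖ ≤ 1 ∧ ∀ i, q i = inner ℝ u (hidden W k (x i))}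

lemma radLE_hiddenClass_zero (n : ℕ → ℕ) {m : ℕ} (x : Fin m → EuclideanSpace ℝ (Fin (n 0)))
    {B : ℝ} (hx : ∀ i, ‖x i‖ ≤ B) : RadLE (hiddenClass n 0 x) (B * √m) := by
  intro t ht
  choose W u _ hu ht using ht
  refine (expect_mono fun ε => ?_).trans (expect_norm_sum_le x hx)
  have e : ∑ i, sgn (ε i) * t ε i = inner ℝ (u ε) (∑ i, sgn (ε i) • x i) := by
    rw [inner_sum]
    exact Finset.sum_congr rfl fun i _ => by rw [ht, real_inner_smul_right, hidden]
  rw [e]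
  exact (real_inner_le_norm _ _).trans (mul_le_of_le_one_left (norm_nonneg _) (hu ε))

/-- A combination with bounded total coefficient is controlled by its largest term, so no factor for
the number of neurons arises. -/
lemma exists_le_mul_abs_of_sum_abs_le {p m : ℕ} {Q : Set (Fin m → ℝ)} (h0 : 0 ∈ Q)
    (c : Fin p → ℝ) (q : Fin p → Fin m → ℝ) (hq : ∀ j, q j ∈ Q) {κ : ℝ} (hc : ∑ j, |c j| ≤ κ)
    (Φ : (Fin m → ℝ) → ℝ) : ∃ q' ∈ Q, ∑ j, c j * Φ (q j) ≤ κ * |Φ q'| := by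
  have hκ : 0 ≤ κ := (Finset.sum_nonneg fun _ _ => abs_nonneg _).trans hc
  rcases isEmpty_or_nonempty (Fin p) with he | hne
  · exact ⟨0, h0, by simpa using mul_nonneg hκ (abs_nonneg _)⟩
  · obtain ⟨j, _, hj⟩ := Finset.exists_max_image Finset.univ (fun j => |Φ (q j)|)
      Finset.univ_nonempty
    refine ⟨q j, hq j, ?_⟩
    calc ∑ k, c k * Φ (q k) ≤ ∑ k, |c k| * |Φ (q j)| := Finset.sum_le_sum fun k hk => by
          refine (le_abs_self _).trans ?_
          rw [abs_mul]
          exact mul_le_mul_of_nonneg_left (hj k hk) (abs_nonneg _)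
      _ = (∑ k, |c k|) * |Φ (q j)| := (Finset.sum_mul ..).symm
      _ ≤ _ := mul_le_mul_of_nonneg_right hc (abs_nonneg _)

/-- The bound `A` stays abstract because one-dimensional input needs better than `2 * C`. -/
lemma radLE_hiddenClass_succ (n : ℕ → ℕ) (k : ℕ) (hn : Even (n (k + 1))) {m : ℕ}
    (x : Fin m → EuclideanSpace ℝ (Fin (n 0))) {C A : ℝ} (hC : RadLE (hiddenClass n k x) C)
    (hA : 0 ∈ hiddenClass n k x → ∀ t : (Fin m → Bool) → Fin m → ℝ,
      (∀ ε, t ε ∈ hiddenClass n k x) → 𝔼 ε, |∑ i, sgn (ε i) * (|t ε i|)| ≤ A) :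
    RadLE (hiddenClass n (k + 1) x) (C + √((min (n (k + 1)) (n k) : ℕ) : ℝ) * A) := by
  intro t ht
  set κ := √((min (n (k + 1)) (n k) : ℕ) : ℝ)
  have hdec : ∀ ε, ∃ l ∈ hiddenClass n k x, ∃ q ∈ hiddenClass n k x,
      ∑ i, sgn (ε i) * t ε i ≤
        ∑ i, sgn (ε i) * l i + κ * |∑ i, sgn (ε i) * (|q i|)| := fun ε => by
    obtain ⟨W, u, hW, hu, htε⟩ := ht ε
    have hW' : ∀ i < k, specNorm (W i) = 1 := fun i hi => hW i (hi.trans k.lt_succ_self)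
    obtain ⟨v, c, r, hv, hr, hc, hz⟩ :=
      groupSort_decomposition hn (hW k k.lt_succ_self) u hu
    have h0 : 0 ∈ hiddenClass n k x := ⟨W, 0, hW', by simp, by simp⟩
    obtain ⟨q, hq, hqle⟩ := exists_le_mul_abs_of_sum_abs_le h0 c
      (fun j i => inner ℝ (r j) (hidden W k (x i))) (fun j => ⟨W, r j, hW', hr j, fun _ => rfl⟩)
      hc fun q => ∑ i, sgn (ε i) * |q i|
    refine ⟨fun i => inner ℝ v (hidden W k (x i)), ⟨W, v, hW', hv, fun _ => rfl⟩, q, hq, ?_⟩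
    refine le_trans (le_of_eq ?_) (add_le_add_right hqle _)
    simp only [htε, hidden, hz, mul_add, Finset.sum_add_distrib, Finset.mul_sum]
    congr 1
    rw [Finset.sum_comm]
    exact Finset.sum_congr rfl fun _ _ => Finset.sum_congr rfl fun _ _ => by ring
  choose l hl q hq hle using hdec
  have h0 : 0 ∈ hiddenClass n k x := by
    obtain ⟨W, -, hW, -, -⟩ := ht fun _ => true
    exact ⟨W, 0, fun i hi => hW i (hi.trans k.lt_succ_self), by simp, by simp⟩
  refine (expect_mono hle).trans ?_
  rw [Finset.expect_add_distrib, ← Finset.mul_expect]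
  exact add_le_add (hC l hl) (mul_le_mul_of_nonneg_left (hA h0 q hq) (Real.sqrt_nonneg _))

/-- In dimension one Cauchy-Schwarz is an equality, so the weight factors out of the sum. This saves
the factor 2 of the general argument, which would give `1 + 2 = 3` in place of 2. -/
lemma expect_abs_hiddenClass_zero_le (n : ℕ → ℕ) (hn : n 0 = 1) {m : ℕ}
    (x : Fin m → EuclideanSpace ℝ (Fin (n 0))) {B : ℝ} (hx : ∀ i, ‖x i‖ ≤ B)
    (t : (Fin m → Bool) → Fin m → ℝ) (ht : ∀ ε, t ε ∈ hiddenClass n 0 x) :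
    𝔼 ε, |∑ i, sgn (ε i) * (|t ε i|)| ≤ B * √m := by
  choose W u _ hu ht using ht
  have hinner : ∀ a b : EuclideanSpace ℝ (Fin (n 0)), |inner ℝ a b| = ‖a‖ * ‖b‖ := by
    rw [hn]
    intro a b
    rw [euclidean_inner, EuclideanSpace.norm_eq, EuclideanSpace.norm_eq]
    simp [abs_mul, Real.sqrt_sq_eq_abs]
  refine (expect_mono fun ε => ?_).trans
    (expect_norm_sum_le (fun i => ‖x i‖) (B := B) fun i => by simpa using hx i)
  have e : ∑ i, sgn (ε i) * |t ε i| = ‖u ε‖ * ∑ i, sgn (ε i) • ‖x i‖ := by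
    rw [Finset.mul_sum]
    exact Finset.sum_congr rfl fun i _ => by
      rw [ht, hidden, hinner, smul_eq_mul]; ring
  rw [e, abs_mul, abs_norm]
  exact mul_le_of_le_one_left (abs_nonneg _) (hu ε)

lemma one_add_sqrt_mul_two_le {μ : ℝ} (hμ : 2 ≤ μ) : 1 + √μ * 2 ≤ 2 * μ := by
  have h1 := Real.sq_sqrt (show (0 : ℝ) ≤ μ by linarith)
  have h2 : (1.4 : ℝ) ≤ √μ := Real.le_sqrt_of_sq_le (by norm_num; linarith)
  nlinarith

lemma radLE_hiddenClass (n : ℕ → ℕ) (k : ℕ) (heven : ∀ i, 1 ≤ i → i ≤ k → Even (n i))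
    (hpos : ∀ i ≤ k, 0 < n i) {m : ℕ} (x : Fin m → EuclideanSpace ℝ (Fin (n 0))) {B : ℝ}
    (hB : 0 ≤ B) (hx : ∀ i, ‖x i‖ ≤ B) :
    RadLE (hiddenClass n k x)
      (B * √m * 2 ^ k * ∏ i ∈ Finset.Icc 1 k, ((min (n i) (n (i - 1)) : ℕ) : ℝ)) := by
  induction k with
  | zero => simpa using radLE_hiddenClass_zero n x hx
  | succ k ih =>
    have ih := ih (fun i h1 h2 => heven i h1 (h2.trans k.le_succ))
      fun i h => hpos i (h.trans k.le_succ)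
    have h2 : 2 ≤ n (k + 1) := by
      obtain ⟨r, hr⟩ := heven (k + 1) (by omega) le_rfl
      have := hpos (k + 1) le_rfl
      omega
    rw [Finset.prod_Icc_succ_top (by omega), Nat.add_sub_cancel]
    -- Positive even widths are at least 2, so width 1 can only be that of the input.
    by_cases hk : n k = 1
    · have hk0 : k = 0 := by
        by_contra h
        obtain ⟨r, hr⟩ := heven k (by omega) k.le_succ
        omega
      subst hk0
      have hmin : min (n (0 + 1)) (n 0) = 1 := by omega
      refine (radLE_hiddenClass_succ n 0 (heven 1 le_rfl le_rfl) x
        (radLE_hiddenClass_zero n x hx)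
        fun _ => expect_abs_hiddenClass_zero_le n hk x hx).mono ?_
      rw [hmin]
      simp
      linarith
    · have h2' : (2 : ℝ) ≤ ((min (n (k + 1)) (n k) : ℕ) : ℝ) := by
        have := hpos k k.le_succ
        have : 2 ≤ min (n (k + 1)) (n k) := by omega
        exact_mod_cast this
      refine (radLE_hiddenClass_succ n k (heven (k + 1) (by omega) le_rfl) x ih
        fun h0 t ht => ih.abs.expect_abs_le ⟨0, h0, by ext; simp⟩ (fun ε i => |t ε i|)
          fun ε => ⟨t ε, ht ε, rfl⟩).mono ?_
      set μ := ((min (n (k + 1)) (n k) : ℕ) : ℝ)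
      set C := B * √m * 2 ^ k * ∏ i ∈ Finset.Icc 1 k, ((min (n i) (n (i - 1)) : ℕ) : ℝ) with hCdef
      have hC0 : 0 ≤ C := by positivity
      calc C + √μ * (2 * C) = C * (1 + √μ * 2) := by ring
        _ ≤ C * (2 * μ) := mul_le_mul_of_nonneg_left (one_add_sqrt_mul_two_le h2') hC0
        _ = _ := by rw [hCdef]; ring

/-- The Rademacher average of the class of real-valued networks. -/
lemma radLE_realClass (n : ℕ → ℕ) (d : ℕ) (heven : ∀ i, 1 ≤ i → i ≤ d - 1 → Even (n i))
    (X : Set (EuclideanSpace ℝ (Fin (n 0)))) {B : ℝ} (hB : 0 ≤ B) (hX : ∀ x ∈ X, ‖x‖ ≤ B)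
    {m : ℕ} (x : Fin m → X) :
    RadLE {q | ∃ f ∈ realClass n d X, ∀ i, q i = f (x i)}
      (B * √m * 2 ^ (d - 1) *
        ∏ i ∈ Finset.Icc 1 (d - 1), ((min (n i) (n (i - 1)) : ℕ) : ℝ)) := by
  intro t ht
  -- A matrix of spectral norm 1 has no empty side; any member of the class supplies such matrices.
  have hpos : ∀ i ≤ d - 1, 0 < n i := by
    obtain ⟨f, ⟨W, V, hW, hV, -⟩, -⟩ := ht fun _ => true
    intro i hi
    rcases hi.lt_or_eq with h | h
    · exact (pos_of_specNorm_eq_one (hW i h)).2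
    · rw [h]
      exact (pos_of_specNorm_eq_one hV).2
  refine radLE_hiddenClass n (d - 1) heven hpos (fun i => (x i : EuclideanSpace ℝ (Fin (n 0))))
    hB (fun i => hX _ (x i).2) t fun ε => ?_
  obtain ⟨f, ⟨W, V, hW, hV, hf⟩, hq⟩ := ht ε
  exact ⟨W, rowVec V 0, hW, norm_rowVec_le hV 0, fun i => by
    rw [hq, hf, toEuclideanLin_apply_eq_inner]⟩
/-! ### Rademacher averages of a Lipschitz loss -/

/-- With the signs of the other components frozen, those of component `k` form an ordinary
Rademacher family. -/
lemma expect_expect_cube_le {K m : ℕ} (k : Fin K) {C : ℝ}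
    (F : (Fin m → Fin K → Bool) → Fin m → ℝ) {Q : Set (Fin m → ℝ)} (hF : ∀ η, F η ∈ Q)
    (hQ : RadLE Q C) : 𝔼 η : Fin m → Fin K → Bool, ∑ i, sgn (η i k) * F η i ≤ C := by
  set e : (Fin m → Fin K → Bool) ≃ (Fin m → Bool) × (Fin m → {j // j ≠ k} → Bool) :=
    (Equiv.piCongrRight fun _ => Equiv.funSplitAt k Bool).trans
      (Equiv.arrowProdEquivProdArrow (Fin m) (fun _ => Bool) fun _ => {j // j ≠ k} → Bool)
  have h1 : 𝔼 η : Fin m → Fin K → Bool, ∑ i, sgn (η i k) * F η i =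
      𝔼 p : (Fin m → Bool) × (Fin m → {j // j ≠ k} → Bool),
        ∑ i, sgn (p.1 i) * F (e.symm p) i :=
    Fintype.expect_equiv e _ _ fun η => by
      rw [Equiv.symm_apply_apply]
      rfl
  rw [h1, ← Finset.univ_product_univ,
    Finset.expect_product' (f := fun ε η' => ∑ i, sgn (ε i) * F (e.symm (ε, η')) i),
    Finset.expect_comm]
  exact Finset.expect_le Finset.univ_nonempty fun η' _ => hQ _ fun ε => hF _

/-- Rademacher averages of Lipschitz functions of vector-valued classes. -/
lemma expect_lipschitz_le {T : Type*} {K m : ℕ} (ψ : Fin m → T → ℝ) (φ : Fin m → Fin K → T → ℝ)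
    {Lr : ℝ} (hLr : 0 ≤ Lr)
    (h : ∀ i t t', |ψ i t - ψ i t'| ≤ Lr * √(∑ k, (φ i k t - φ i k t') ^ 2)) {C : ℝ}
    (hC : ∀ k, RadLE {q | ∃ t, ∀ i, q i = φ i k t} C) (t : (Fin m → Bool) → T) :
    𝔼 ε, ∑ i, sgn (ε i) * ψ i (t ε) ≤ √2 * Lr * K * C := by
  obtain ⟨t', ht'⟩ := contraction (fun _ => 0) ψ (fun i k t => √2 * Lr * φ i k t)
    (fun i t t' => by
      refine (h i t t').trans ((mul_le_mul_of_nonneg_left (khintchine _) hLr).trans_eq ?_)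
      rw [Finset.mul_expect, Finset.mul_expect]
      refine Finset.expect_congr rfl fun η _ => ?_
      have e : ∑ k, sgn (η k) * (√2 * Lr * φ i k t - √2 * Lr * φ i k t') =
          (Lr * √2) * ∑ k, sgn (η k) * (φ i k t - φ i k t') := by
        rw [Finset.mul_sum]
        exact Finset.sum_congr rfl fun _ _ => by ring
      rw [e, abs_mul, abs_of_nonneg (by positivity : 0 ≤ Lr * √2), mul_assoc]) t
  simp only [zero_add] at ht'
  refine ht'.trans ?_
  calc 𝔼 η : Fin m → Fin K → Bool, ∑ i, ∑ k, sgn (η i k) * (√2 * Lr * φ i k (t' η))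
      = √2 * Lr * ∑ k, 𝔼 η : Fin m → Fin K → Bool, ∑ i, sgn (η i k) * φ i k (t' η) := by
        rw [← Finset.expect_sum_comm, Finset.mul_expect]
        refine Finset.expect_congr rfl fun η _ => ?_
        rw [Finset.sum_comm, Finset.mul_sum]
        refine Finset.sum_congr rfl fun k _ => ?_
        rw [Finset.mul_sum]
        exact Finset.sum_congr rfl fun _ _ => by ring
    _ ≤ √2 * Lr * ∑ _k : Fin K, C := by
        refine mul_le_mul_of_nonneg_left (Finset.sum_le_sum fun k _ => ?_) (by positivity)
        exact expect_expect_cube_le (Q := {q | ∃ t, ∀ i, q i = φ i k t}) k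
          (fun η i => φ i k (t' η)) (fun η => ⟨t' η, fun _ => rfl⟩) (hC k)
    _ = √2 * Lr * K * C := by
        simp
        ring

/-! ### Symmetrization -/

section

variable {ι : Type*} [Finite ι] [Nonempty ι]

lemma ciSup_sub_le {f g : ι → ℝ} {c : ℝ} (h : ∀ j, f j ≤ g j + c) :
    ⨆ j, f j ≤ (⨆ j, g j) + c :=
  ciSup_le fun j => (h j).trans (add_le_add_left (le_ciSup (Set.finite_range g).bddAbove j) c)

lemma abs_ciSup_sub_ciSup_le {f g : ι → ℝ} {c : ℝ} (h : ∀ j, |f j - g j| ≤ c) :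
    |(⨆ j, f j) - ⨆ j, g j| ≤ c := by
  have h1 := ciSup_sub_le (f := f) (g := g) fun j => by linarith [(abs_le.1 (h j)).2]
  have h2 := ciSup_sub_le (f := g) (g := f) fun j => by linarith [(abs_le.1 (h j)).1]
  rw [abs_le]
  constructor <;> linarith

/-- The exponential moment of a Rademacher supremum of differences. -/
lemma expect_exp_ciSup_le {m : ℕ} (a b : ι → Fin m → ℝ) {M R : ℝ}
    (ha : ∀ j i, a j i ∈ Set.Icc 0 M) (hb : ∀ j i, b j i ∈ Set.Icc 0 M)
    (hRa : ∀ t : (Fin m → Bool) → ι, 𝔼 ε, ∑ i, sgn (ε i) * a (t ε) i ≤ R)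
    (hRb : ∀ t : (Fin m → Bool) → ι, 𝔼 ε, ∑ i, sgn (ε i) * b (t ε) i ≤ R)
    {s : ℝ} (hs : 0 ≤ s) :
    𝔼 ε : Fin m → Bool, Real.exp (s * ⨆ j, ∑ i, sgn (ε i) * (a j i - b j i)) ≤
      Real.exp (s * (2 * R) + m * s ^ 2 * M ^ 2 / 2) := by
  set g : (Fin m → Bool) → ℝ := fun ε => ⨆ j, ∑ i, sgn (ε i) * (a j i - b j i)
  have hdiff : ∀ ε i, |s * g ε - s * g (flipAt ε i)| ≤ 2 * s * M := fun ε i => by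
    rw [← mul_sub, abs_mul, abs_of_nonneg hs, mul_comm 2 s, mul_assoc]
    refine mul_le_mul_of_nonneg_left (abs_ciSup_sub_ciSup_le fun j => ?_) hs
    rw [← Finset.sum_sub_distrib, Finset.sum_eq_single i]
    · rw [flipAt, Function.update_self, sgn_not]
      have e : sgn (ε i) * (a j i - b j i) - -sgn (ε i) * (a j i - b j i) =
          sgn (ε i) * (2 * (a j i - b j i)) := by ring
      rw [e, abs_mul, abs_sgn, one_mul, abs_mul, abs_two]
      refine mul_le_mul_of_nonneg_left ?_ zero_le_two
      rw [abs_le]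
      constructor <;> linarith [(ha j i).1, (ha j i).2, (hb j i).1, (hb j i).2]
    · intro k _ hk
      rw [flipAt, Function.update_of_ne hk, sub_self]
    · simp
  have hmean : 𝔼 ε, g ε ≤ 2 * R := by
    -- Maximizers over the finite family serve as choice functions; the antipode absorbs the minus
    -- sign of `b`.
    have hatt : ∀ ε, ∃ j, ∑ i, sgn (ε i) * (a j i - b j i) = g ε := fun ε =>
      exists_eq_ciSup_of_finite
    choose t ht using hatt
    have h2 := hRb fun ε => t (antipode _ ε)
    rw [← expect_antipode] at h2
    have e : ∀ ε, g ε = ∑ i, sgn (ε i) * a (t ε) i +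
        ∑ i, sgn (antipode _ ε i) * b (t (antipode _ (antipode _ ε))) i := fun ε => by
      have e' : antipode _ (antipode _ ε) = ε := by ext i; simp
      rw [e', ← ht ε, ← Finset.sum_add_distrib]
      exact Finset.sum_congr rfl fun i _ => by rw [antipode_apply, sgn_not]; ring
    simp only [e, Finset.expect_add_distrib]
    linarith [hRa t]
  refine (expect_exp_le (fun ε => s * g ε) hdiff).trans (Real.exp_le_exp.2 ?_)
  rw [← Finset.mul_expect]
  have := mul_le_mul_of_nonneg_left hmean hs
  nlinarith

end

/-! ### Ghost samples and tail bounds -/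

section

variable {ι α : Type*}

/-- Interchange of the two components of the coordinates `i` with `ε i = false`. -/
def swapAt {m : ℕ} (ε : Fin m → Bool) (w : Fin m → α × α) : Fin m → α × α :=
  fun i => (if ε i then id else Prod.swap) (w i)

lemma measurePreserving_swapAt [MeasurableSpace α] {m : ℕ} (D : Measure α) [IsProbabilityMeasure D]
    (ε : Fin m → Bool) : MeasurePreserving (swapAt ε)
      (Measure.pi fun _ : Fin m => D.prod D) (Measure.pi fun _ : Fin m => D.prod D) := by
  refine measurePreserving_pi (f := fun i => if ε i then id else Prod.swap) _ _ fun i => ?_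
  split_ifs
  exacts [MeasurePreserving.id _, Measure.measurePreserving_swap]

variable (ℓ : ι → α → ℝ)

/-- The supremum of the differences of the losses on two samples. -/
noncomputable def ghostSup {m : ℕ} (z z' : Fin m → α) : ℝ := ⨆ j, ∑ i, (ℓ j (z' i) - ℓ j (z i))

/-- The supremum of the differences of the expected loss and the loss on a sample. -/
noncomputable def deviationSup [MeasurableSpace α] (D : Measure α) {m : ℕ} (z : Fin m → α) : ℝ :=
  ⨆ j, ∑ i, (∫ a, ℓ j a ∂D - ℓ j (z i))

variable {ℓ} {M : ℝ}

lemma measurable_ghostSup [Finite ι] [MeasurableSpace α] (hℓ : ∀ j, Measurable (ℓ j)) (m : ℕ) :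
    Measurable fun p : (Fin m → α) × (Fin m → α) => ghostSup ℓ p.1 p.2 :=
  Measurable.iSup fun j => Finset.measurable_sum _ fun i _ =>
    ((hℓ j).comp ((measurable_pi_apply i).comp measurable_snd)).sub
      ((hℓ j).comp ((measurable_pi_apply i).comp measurable_fst))

lemma measurable_deviationSup [Finite ι] [MeasurableSpace α]
    (hℓ : ∀ j, Measurable (ℓ j)) (D : Measure α) (m : ℕ) :
    Measurable fun z : Fin m → α => deviationSup ℓ D z :=
  Measurable.iSup fun j => Finset.measurable_sum _ fun i _ =>
    measurable_const.sub ((hℓ j).comp (measurable_pi_apply i))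

lemma integrable_of_mem_Icc [MeasurableSpace α] {D : Measure α} [IsProbabilityMeasure D] {f : α → ℝ}
    (hf : Measurable f) (hM : ∀ a, f a ∈ Set.Icc 0 M) : Integrable f D :=
  Integrable.of_bound hf.aestronglyMeasurable M
    (Filter.Eventually.of_forall fun a => by
      rw [Real.norm_of_nonneg (hM a).1]
      exact (hM a).2)

lemma ghostSup_le [Nonempty ι] (hM : ∀ j a, ℓ j a ∈ Set.Icc 0 M) {m : ℕ} (z z' : Fin m → α) :
    ghostSup ℓ z z' ≤ m * M := by
  refine ciSup_le fun j => ?_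
  calc ∑ i, (ℓ j (z' i) - ℓ j (z i)) ≤ ∑ _i : Fin m, M :=
        Finset.sum_le_sum fun i _ => by linarith [(hM j (z' i)).2, (hM j (z i)).1]
    _ = m * M := by simp

lemma norm_exp_ghostSup_le [Nonempty ι] (hM : ∀ j a, ℓ j a ∈ Set.Icc 0 M) {m : ℕ} {s : ℝ} (hs : 0 ≤ s)
    (z z' : Fin m → α) : ‖Real.exp (s * ghostSup ℓ z z')‖ ≤ Real.exp (s * (m * M)) := by
  rw [Real.norm_of_nonneg (Real.exp_pos _).le, Real.exp_le_exp]
  exact mul_le_mul_of_nonneg_left (ghostSup_le hM z z') hs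

lemma integrable_exp_ghostSup [Finite ι] [Nonempty ι] [MeasurableSpace α]
    (hℓ : ∀ j, Measurable (ℓ j)) (hM : ∀ j a, ℓ j a ∈ Set.Icc 0 M)
    {m : ℕ} {s : ℝ} (hs : 0 ≤ s) {Ω : Type*} [MeasurableSpace Ω] (μ : Measure Ω)
    [IsProbabilityMeasure μ] {f : Ω → (Fin m → α) × (Fin m → α)} (hf : Measurable f) :
    Integrable (fun ω => Real.exp (s * ghostSup ℓ (f ω).1 (f ω).2)) μ :=
  Integrable.of_bound
    (Real.measurable_exp.comp
      (((measurable_ghostSup hℓ m).comp hf).const_mul s)).aestronglyMeasurable _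
    (Filter.Eventually.of_forall fun _ => norm_exp_ghostSup_le hM hs _ _)

/-- Jensen's inequality is applied to the loss that attains the supremum, and the supremum restored
afterwards. -/
lemma exp_deviationSup_le [Finite ι] [Nonempty ι] [MeasurableSpace α]
    (hℓ : ∀ j, Measurable (ℓ j)) (hM : ∀ j a, ℓ j a ∈ Set.Icc 0 M)
    (D : Measure α) [IsProbabilityMeasure D] {m : ℕ} {s : ℝ} (hs : 0 ≤ s) (z : Fin m → α) :
    Real.exp (s * deviationSup ℓ D z) ≤
      ∫ z', Real.exp (s * ghostSup ℓ z z') ∂Measure.pi fun _ : Fin m => D := by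
  obtain ⟨j, hj⟩ : ∃ j, ∑ i, (∫ a, ℓ j a ∂D - ℓ j (z i)) = deviationSup ℓ D z :=
    exists_eq_ciSup_of_finite
  set ν := Measure.pi fun _ : Fin m => D
  have hint : ∀ i : Fin m, Integrable (fun z' : Fin m → α => ℓ j (z' i)) ν := fun i =>
    integrable_of_mem_Icc ((hℓ j).comp (measurable_pi_apply i)) fun z' => hM j (z' i)
  have hmean : ∀ i : Fin m, ∫ z' : Fin m → α, ℓ j (z' i) ∂ν = ∫ a, ℓ j a ∂D := fun i => by
    have hmp := measurePreserving_eval (fun _ : Fin m => D) i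
    rw [← hmp.map_eq]
    exact (integral_map hmp.measurable.aemeasurable (hℓ j).aestronglyMeasurable).symm
  have hsub : ∀ i ∈ Finset.univ,
      Integrable (fun z' : Fin m → α => ℓ j (z' i) - ℓ j (z i)) ν := fun i _ =>
    (hint i).sub (integrable_const _)
  have hint' : Integrable (fun z' : Fin m → α => s * ∑ i, (ℓ j (z' i) - ℓ j (z i))) ν :=
    (integrable_finsetSum _ hsub).const_mul s
  have hle : ∀ z' : Fin m → α, Real.exp (s * ∑ i, (ℓ j (z' i) - ℓ j (z i))) ≤
      Real.exp (s * ghostSup ℓ z z') := fun z' => by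
    rw [Real.exp_le_exp]
    exact mul_le_mul_of_nonneg_left
      (le_ciSup (f := fun j => ∑ i, (ℓ j (z' i) - ℓ j (z i))) (Set.finite_range _).bddAbove j) hs
  have hI := integrable_exp_ghostSup hℓ hM hs ν
    (f := fun z' => (z, z')) measurable_prodMk_left
  have hI' : Integrable (Real.exp ∘ fun z' : Fin m → α => s * ∑ i, (ℓ j (z' i) - ℓ j (z i))) ν :=
    hI.mono' (Real.continuous_exp.comp_aestronglyMeasurable hint'.aestronglyMeasurable)
      (Filter.Eventually.of_forall fun z' => by
        rw [Function.comp_apply, Real.norm_of_nonneg (Real.exp_pos _).le]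
        exact hle z')
  have hjen := convexOn_exp.map_integral_le (μ := ν) Real.continuous_exp.continuousOn isClosed_univ
    (Filter.Eventually.of_forall fun _ => Set.mem_univ _) hint' hI'
  have e : ∫ z' : Fin m → α, s * ∑ i, (ℓ j (z' i) - ℓ j (z i)) ∂ν = s * deviationSup ℓ D z := by
    rw [integral_const_mul, integral_finsetSum _ hsub, ← hj]
    congr 1
    refine Finset.sum_congr rfl fun i _ => ?_
    rw [integral_sub (hint i) (integrable_const _), hmean]
    simp
  rw [e] at hjen
  exact hjen.trans (integral_mono hI' hI hle)

lemma ghostSup_swapAt {m : ℕ} (ε : Fin m → Bool) (w : Fin m → α × α) :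
    ghostSup ℓ (fun i => (swapAt ε w i).1) (fun i => (swapAt ε w i).2) =
      ⨆ j, ∑ i, sgn (ε i) * (ℓ j (w i).2 - ℓ j (w i).1) := by
  refine iSup_congr fun j => Finset.sum_congr rfl fun i _ => ?_
  cases h : ε i <;> simp [swapAt, h]

lemma measurePreserving_unzip [MeasurableSpace α] (D : Measure α) [IsProbabilityMeasure D]
    (m : ℕ) : MeasurePreserving
      (fun w : Fin m → α × α => (fun i => (w i).1, fun i => (w i).2))
      (Measure.pi fun _ : Fin m => D.prod D)
      ((Measure.pi fun _ : Fin m => D).prod (Measure.pi fun _ : Fin m => D)) :=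
  measurePreserving_arrowProdEquivProdArrow α α (Fin m) (fun _ => D) (fun _ => D)

/-- The exponential moment of the supremum of the differences of the losses on two samples. -/
lemma integral_exp_ghostSup_le [Finite ι] [Nonempty ι] [MeasurableSpace α]
    (hℓ : ∀ j, Measurable (ℓ j)) (hM : ∀ j a, ℓ j a ∈ Set.Icc 0 M) (D : Measure α)
    [IsProbabilityMeasure D] {m : ℕ} {R : ℝ}
    (hR : ∀ (z : Fin m → α) (t : (Fin m → Bool) → ι),
      𝔼 ε, ∑ i, sgn (ε i) * ℓ (t ε) (z i) ≤ R) {s : ℝ} (hs : 0 ≤ s) :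
    ∫ w : Fin m → α × α, Real.exp (s * ghostSup ℓ (fun i => (w i).1) (fun i => (w i).2))
        ∂(Measure.pi fun _ : Fin m => D.prod D) ≤
      Real.exp (s * (2 * R) + m * s ^ 2 * M ^ 2 / 2) := by
  obtain ⟨F, hF⟩ : ∃ F : (Fin m → α × α) → ℝ, ∀ w, F w =
      Real.exp (s * ghostSup ℓ (fun i => (w i).1) (fun i => (w i).2)) := ⟨_, fun _ => rfl⟩
  simp only [← hF]
  have hunzip := (measurePreserving_unzip D m).measurable
  have hFint : ∀ ε : Fin m → Bool,
      Integrable (fun w => F (swapAt ε w)) (Measure.pi fun _ : Fin m => D.prod D) := fun ε => by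
    simp only [hF]
    have hmeas : Measurable fun w : Fin m → α × α =>
        ((fun i => (swapAt ε w i).1, fun i => (swapAt ε w i).2) : (Fin m → α) × (Fin m → α)) :=
      hunzip.comp (measurePreserving_swapAt D ε).measurable
    have h := integrable_exp_ghostSup hℓ hM hs (Measure.pi fun _ : Fin m => D.prod D)
      (f := fun w => (fun i => (swapAt ε w i).1, fun i => (swapAt ε w i).2)) hmeas
    exact h
  have hFmeas : Measurable F := by
    rw [funext hF]
    have hmeas : Measurable fun w : Fin m → α × α =>
        ghostSup ℓ (fun i => (w i).1) (fun i => (w i).2) := (measurable_ghostSup hℓ m).comp hunzip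
    exact Real.measurable_exp.comp (hmeas.const_mul s)
  have hswap : ∀ ε : Fin m → Bool, ∫ w, F (swapAt ε w) ∂(Measure.pi fun _ : Fin m => D.prod D) =
      ∫ w, F w ∂(Measure.pi fun _ : Fin m => D.prod D) := fun ε => by
    have hmp := measurePreserving_swapAt (m := m) D ε
    rw [← integral_map hmp.measurable.aemeasurable hFmeas.aestronglyMeasurable, hmp.map_eq]
  -- For a fixed double sample, the average over all swaps is a Rademacher moment.
  have hexp : ∀ w, 𝔼 ε : Fin m → Bool, F (swapAt ε w) ≤
      Real.exp (s * (2 * R) + m * s ^ 2 * M ^ 2 / 2) := fun w => by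
    simp only [hF, ghostSup_swapAt]
    exact expect_exp_ciSup_le (fun j i => ℓ j (w i).2) (fun j i => ℓ j (w i).1)
      (fun _ _ => hM _ _) (fun _ _ => hM _ _) (hR fun i => (w i).2) (hR fun i => (w i).1) hs
  simp only [Fintype.expect_eq_sum_div_card] at hexp
  have h := integral_mono ((integrable_finsetSum _ fun ε _ => hFint ε).div_const _)
    (integrable_const _) hexp
  rw [integral_div, integral_finsetSum _ fun ε _ => hFint ε] at h
  simpa [hswap] using h

/-- The exponential moment of the uniform deviation. -/
lemma integral_exp_deviationSup_le [Finite ι] [Nonempty ι] [MeasurableSpace α]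
    (hℓ : ∀ j, Measurable (ℓ j)) (hM : ∀ j a, ℓ j a ∈ Set.Icc 0 M) (D : Measure α)
    [IsProbabilityMeasure D] {m : ℕ} {R : ℝ}
    (hR : ∀ (z : Fin m → α) (t : (Fin m → Bool) → ι),
      𝔼 ε, ∑ i, sgn (ε i) * ℓ (t ε) (z i) ≤ R) {s : ℝ} (hs : 0 ≤ s) :
    Integrable (fun z : Fin m → α => Real.exp (s * deviationSup ℓ D z))
        (Measure.pi fun _ : Fin m => D) ∧
      ∫ z, Real.exp (s * deviationSup ℓ D z) ∂(Measure.pi fun _ : Fin m => D) ≤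
        Real.exp (s * (2 * R) + m * s ^ 2 * M ^ 2 / 2) := by
  have hI := integrable_exp_ghostSup hℓ hM hs
    ((Measure.pi fun _ : Fin m => D).prod (Measure.pi fun _ : Fin m => D))
    (f := fun p => p) measurable_id
  have hJ : Integrable (fun z : Fin m → α => Real.exp (s * deviationSup ℓ D z))
      (Measure.pi fun _ : Fin m => D) :=
    hI.integral_prod_left.mono'
      (Real.measurable_exp.comp
        ((measurable_deviationSup hℓ D m).const_mul s)).aestronglyMeasurable
      (Filter.Eventually.of_forall fun z => by
        rw [Real.norm_of_nonneg (Real.exp_pos _).le]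
        exact exp_deviationSup_le hℓ hM D hs z)
  refine ⟨hJ, (integral_mono hJ hI.integral_prod_left
    (exp_deviationSup_le hℓ hM D hs)).trans ?_⟩
  refine le_trans (le_of_eq ?_) (integral_exp_ghostSup_le hℓ hM D hR hs)
  have hunzip := measurePreserving_unzip D m
  rw [← integral_prod _ hI]
  rw [← hunzip.map_eq] at hI ⊢
  exact integral_map hunzip.measurable.aemeasurable hI.aestronglyMeasurable

/-- The tail of the uniform deviation over a finite family. -/
lemma measure_deviationSup_ge_le [Finite ι] [Nonempty ι] [MeasurableSpace α]
    (hℓ : ∀ j, Measurable (ℓ j)) (hMpos : 0 < M)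
    (hM : ∀ j a, ℓ j a ∈ Set.Icc 0 M) (D : Measure α) [IsProbabilityMeasure D] {m : ℕ}
    (hm : 0 < m) {R : ℝ}
    (hR : ∀ (z : Fin m → α) (t : (Fin m → Bool) → ι),
      𝔼 ε, ∑ i, sgn (ε i) * ℓ (t ε) (z i) ≤ R) {τ : ℝ} (hτ : 0 ≤ τ) :
    (Measure.pi fun _ : Fin m => D).real {z | 2 * R + τ ≤ deviationSup ℓ D z} ≤
      Real.exp (-(τ ^ 2 / (2 * m * M ^ 2))) := by
  have hm' : (0 : ℝ) < m := Nat.cast_pos.2 hm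
  -- This `s` minimizes the Chernoff exponent `-s τ + m s² M² / 2`.
  have hs : 0 ≤ τ / (m * M ^ 2) := by positivity
  obtain ⟨hJ, hle⟩ := integral_exp_deviationSup_le hℓ hM D hR hs
  refine (measure_ge_le_exp_mul_mgf _ hs hJ).trans
    ((mul_le_mul_of_nonneg_left hle (Real.exp_pos _).le).trans_eq ?_)
  rw [← Real.exp_add]
  congr 1
  field_simp
  ring

end

/-- Uniform deviation over a sequence of losses. -/
lemma measure_exists_deviation_gt_le {α : Type*} [MeasurableSpace α] (ℓ : ℕ → α → ℝ)
    (hℓ : ∀ j, Measurable (ℓ j)) {M : ℝ} (hMpos : 0 < M) (hM : ∀ j a, ℓ j a ∈ Set.Icc 0 M)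
    (D : Measure α) [IsProbabilityMeasure D] {m : ℕ} (hm : 0 < m) {R : ℝ}
    (hR : ∀ (z : Fin m → α) (t : (Fin m → Bool) → ℕ),
      𝔼 ε, ∑ i, sgn (ε i) * ℓ (t ε) (z i) ≤ R) {τ : ℝ} (hτ : 0 ≤ τ) :
    (Measure.pi fun _ : Fin m => D)
        {z | ∃ j, 2 * R + τ < ∑ i, (∫ a, ℓ j a ∂D - ℓ j (z i))} ≤
      ENNReal.ofReal (Real.exp (-(τ ^ 2 / (2 * m * M ^ 2)))) := by
  set A : ℕ → Set (Fin m → α) := fun N =>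
    {z | ∃ j ≤ N, 2 * R + τ < ∑ i, (∫ a, ℓ j a ∂D - ℓ j (z i))}
  have hA : Monotone A := fun N N' h z ⟨j, hj, hz⟩ => ⟨j, hj.trans h, hz⟩
  have e : {z : Fin m → α | ∃ j, 2 * R + τ < ∑ i, (∫ a, ℓ j a ∂D - ℓ j (z i))} = ⋃ N, A N := by
    ext z
    simp only [A, Set.mem_iUnion, Set.mem_ofPred_eq]
    exact ⟨fun ⟨j, hj⟩ => ⟨j, j, le_rfl, hj⟩, fun ⟨_, j, _, hj⟩ => ⟨j, hj⟩⟩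
  rw [e, hA.measure_iUnion]
  refine iSup_le fun N => ?_
  have hfin := measure_deviationSup_ge_le (ι := Fin (N + 1)) (ℓ := fun j => ℓ j)
    (fun j => hℓ j) hMpos (fun j => hM j) D hm (fun z t => hR z fun ε => t ε) hτ
  refine (measure_mono fun z hz => ?_).trans
    (ENNReal.le_ofReal_iff_toReal_le (measure_ne_top _ _) (Real.exp_pos _).le |>.2 hfin)
  obtain ⟨j, hj, hz⟩ := hz
  exact hz.le.trans (le_ciSup (f := fun j : Fin (N + 1) => ∑ i, (∫ a, ℓ j a ∂D - ℓ j (z i)))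
    (Set.finite_range _).bddAbove ⟨j, Nat.lt_succ_of_le hj⟩)
/-! ### Continuity of networks in the weights -/

lemma continuous_groupSort {k : ℕ} : Continuous (groupSort (k := k)) := by
  refine (PiLp.continuous_toLp 2 _).comp (continuous_pi fun i => ?_)
  have hc : ∀ j : Fin k, Continuous fun x : EuclideanSpace ℝ (Fin k) => x j := fun j => by
    fun_prop
  split_ifs
  exacts [(hc _).max (hc _), hc _, (hc _).min (hc _)]

lemma continuous_hidden {n : ℕ → ℕ} (k : ℕ) : Continuous fun p :
    (∀ i : ℕ, Matrix (Fin (n (i + 1))) (Fin (n i)) ℝ) × EuclideanSpace ℝ (Fin (n 0)) =>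
      hidden p.1 k p.2 := by
  induction k with
  | zero => exact continuous_snd
  | succ k ih =>
    refine continuous_groupSort.comp ?_
    simp only [Matrix.toLpLin_apply]
    refine (PiLp.continuous_toLp 2 _).comp (Continuous.matrix_mulVec ?_ ?_)
    · exact (continuous_apply k).comp continuous_fst
    · exact (PiLp.continuous_ofLp 2 _).comp ih

/-- The weights of a real-valued network of depth `d`. -/
abbrev Weights (n : ℕ → ℕ) (d : ℕ) : Type :=
  (∀ i : ℕ, Matrix (Fin (n (i + 1))) (Fin (n i)) ℝ) × Matrix (Fin 1) (Fin (n (d - 1))) ℝ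

/-- Makes the weight space second countable, for a dense sequence of networks and for dominated
convergence in the weights. -/
instance {p q : ℕ} : SecondCountableTopology (Matrix (Fin p) (Fin q) ℝ) :=
  inferInstanceAs (SecondCountableTopology (Fin p → Fin q → ℝ))

/-- The real-valued network with given weights. -/
noncomputable def network {n : ℕ → ℕ} {d : ℕ}
    (θ : Weights n d) (x : EuclideanSpace ℝ (Fin (n 0))) : ℝ :=
  Matrix.toEuclideanLin θ.2 (hidden θ.1 (d - 1) x) 0

lemma continuous_network {n : ℕ → ℕ} {d : ℕ} :
    Continuous fun p : Weights n d × EuclideanSpace ℝ (Fin (n 0)) => network p.1 p.2 := by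
  simp only [network, Matrix.toLpLin_apply]
  refine (continuous_apply (0 : Fin 1)).comp (Continuous.matrix_mulVec ?_ ?_)
  · exact continuous_snd.comp continuous_fst
  · exact (PiLp.continuous_ofLp 2 _).comp
      ((continuous_hidden (d - 1)).comp ((continuous_fst.comp continuous_fst).prodMk continuous_snd))

lemma mem_realClass_iff {n : ℕ → ℕ} {d : ℕ} {X : Set (EuclideanSpace ℝ (Fin (n 0)))}
    {f : X → ℝ} : f ∈ realClass n d X ↔ ∃ θ : Weights n d,
      ((∀ i < d - 1, specNorm (θ.1 i) = 1) ∧ specNorm θ.2 = 1) ∧ ∀ x : X, f x = network θ x :=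
  ⟨fun ⟨W, V, hW, hV, h⟩ => ⟨(W, V), ⟨hW, hV⟩, h⟩, fun ⟨θ, ⟨hW, hV⟩, h⟩ => ⟨θ.1, θ.2, hW, hV, h⟩⟩

/-! ### Generalization of bounded Lipschitz losses -/

section

variable {d dy : ℕ} {n : ℕ → ℕ} {X : Set (EuclideanSpace ℝ (Fin (n 0)))}
  {Y : Set (EuclideanSpace ℝ (Fin dy))}

/-- The weights of the vector-valued networks with values in `Y`. -/
def vectorWeights (n : ℕ → ℕ) (d : ℕ) {dy : ℕ} (X : Set (EuclideanSpace ℝ (Fin (n 0))))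
    (Y : Set (EuclideanSpace ℝ (Fin dy))) : Set (Fin dy → Weights n d) :=
  {θ | (∀ k, (∀ i < d - 1, specNorm ((θ k).1 i) = 1) ∧ specNorm (θ k).2 = 1) ∧
    ∀ x : X, WithLp.toLp 2 (fun k => network (θ k) x) ∈ Y}

/-- The vector-valued network with given weights. -/
noncomputable def vectorNetwork (θ : vectorWeights n d X Y) (x : X) : Y :=
  ⟨WithLp.toLp 2 fun k => network (θ.1 k) x, θ.2.2 x⟩

lemma vectorNetwork_mem (θ : vectorWeights n d X Y) : vectorNetwork θ ∈ vectorClass n d X Y :=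
  fun k => mem_realClass_iff.2 ⟨θ.1 k, θ.2.1 k, fun _ => rfl⟩

lemma exists_eq_vectorNetwork {h : X → Y} (hh : h ∈ vectorClass n d X Y) :
    ∃ θ : vectorWeights n d X Y, h = vectorNetwork θ := by
  choose θ hθ hx using fun k => mem_realClass_iff.1 (hh k)
  have e : ∀ x : X, WithLp.toLp 2 (fun k => network (θ k) x) = (h x : EuclideanSpace ℝ (Fin dy)) :=
    fun x : X => by
      ext k
      exact (hx k x).symm
  exact ⟨⟨θ, hθ, fun x => e x ▸ (h x).2⟩, funext fun x => Subtype.ext (e x).symm⟩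

lemma continuous_vectorNetwork :
    Continuous fun p : vectorWeights n d X Y × X => vectorNetwork p.1 p.2 := by
  have h : ∀ k : Fin dy, Continuous fun p : vectorWeights n d X Y × X =>
      network ((p.1 : Fin dy → Weights n d) k) p.2 := fun k => by
    have h1 : Continuous fun p : vectorWeights n d X Y × X =>
        (p.1 : Fin dy → Weights n d) k :=
      (continuous_apply k).comp (continuous_subtype_val.comp continuous_fst)
    have h2 : Continuous fun p : vectorWeights n d X Y × X =>
        (p.2 : EuclideanSpace ℝ (Fin (n 0))) := continuous_subtype_val.comp continuous_snd
    have h3 : Continuous fun p : vectorWeights n d X Y × X =>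
        ((p.1 : Fin dy → Weights n d) k, (p.2 : EuclideanSpace ℝ (Fin (n 0)))) := h1.prodMk h2
    exact continuous_network.comp h3
  have h' : Continuous fun p : vectorWeights n d X Y × X =>
      WithLp.toLp 2 fun k => network ((p.1 : Fin dy → Weights n d) k) p.2 :=
    (PiLp.continuous_toLp 2 _).comp (continuous_pi h)
  exact h'.subtype_mk _

lemma continuous_vectorNetwork_right (θ : vectorWeights n d X Y) :
    Continuous (vectorNetwork θ) :=
  continuous_vectorNetwork.comp (f := fun x : X => (θ, x)) (by fun_prop)

lemma continuous_vectorNetwork_left (x : X) :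
    Continuous fun θ : vectorWeights n d X Y => vectorNetwork θ x :=
  continuous_vectorNetwork.comp (f := fun θ : vectorWeights n d X Y => (θ, x)) (by fun_prop)

variable {L : Y → Y → ℝ} {M Lr : ℝ}

lemma measurable_loss (hL : Measurable (Function.uncurry L)) (θ : vectorWeights n d X Y) :
    Measurable fun z : X × Y => L (vectorNetwork θ z.1) z.2 :=
  hL.comp (((continuous_vectorNetwork_right θ).measurable.comp measurable_fst).prodMk
    measurable_snd)

lemma continuous_loss
    (hL_lip : ∀ y' y₁ y₂ : Y, |L y₁ y' - L y₂ y'| ≤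
      Lr * ‖(y₁ : EuclideanSpace ℝ (Fin dy)) - (y₂ : EuclideanSpace ℝ (Fin dy))‖) (z : X × Y) :
    Continuous fun θ : vectorWeights n d X Y => L (vectorNetwork θ z.1) z.2 := by
  have hlip : LipschitzWith Lr.toNNReal fun y => L y z.2 :=
    LipschitzWith.of_dist_le_mul fun y₁ y₂ => by
      rw [Real.dist_eq, Subtype.dist_eq, dist_eq_norm]
      exact (hL_lip _ _ _).trans
        (mul_le_mul_of_nonneg_right (Real.le_coe_toNNReal _) (norm_nonneg _))
  exact hlip.continuous.comp (continuous_vectorNetwork_left z.1)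

/-- The Rademacher average of the losses of the vector-valued networks. -/
lemma expect_loss_le (heven : ∀ i, 1 ≤ i → i ≤ d - 1 → Even (n i)) {B : ℝ} (hB : 0 ≤ B)
    (hX : ∀ x ∈ X, ‖x‖ ≤ B) (hLr : 0 ≤ Lr)
    (hL_lip : ∀ y' y₁ y₂ : Y, |L y₁ y' - L y₂ y'| ≤
      Lr * ‖(y₁ : EuclideanSpace ℝ (Fin dy)) - (y₂ : EuclideanSpace ℝ (Fin dy))‖)
    {m : ℕ} (z : Fin m → X × Y) (t : (Fin m → Bool) → vectorWeights n d X Y) :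
    𝔼 ε, ∑ i, sgn (ε i) * L (vectorNetwork (t ε) (z i).1) (z i).2 ≤
      √2 * Lr * dy * (B * √m * 2 ^ (d - 1) *
        ∏ i ∈ Finset.Icc 1 (d - 1), ((min (n i) (n (i - 1)) : ℕ) : ℝ)) := by
  refine expect_lipschitz_le (fun i θ => L (vectorNetwork θ (z i).1) (z i).2)
    (fun i k θ => (vectorNetwork θ (z i).1 : EuclideanSpace ℝ (Fin dy)) k) hLr
    (fun i θ θ' => ?_) (fun k q hq => ?_) t
  · refine (hL_lip _ _ _).trans_eq ?_
    rw [EuclideanSpace.norm_eq]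
    simp
  · refine radLE_realClass n d heven X hB hX (fun i => (z i).1) q fun ε => ?_
    obtain ⟨θ, hθ⟩ := hq ε
    exact ⟨_, vectorNetwork_mem θ k, hθ⟩

end

end LCNN

/-! ### The generalization bound -/

theorem mainTheorem5
    -- depth, layer widths (`n 0` is the input dimension), output dimension
    (d : ℕ) (hd : 1 ≤ d) (n : ℕ → ℕ) (hn : ∀ i, 1 ≤ i → i ≤ d - 1 → Even (n i)) (dy : ℕ)
    -- bounded input domain and output domain
    (X : Set (EuclideanSpace ℝ (Fin (n 0)))) (Y : Set (EuclideanSpace ℝ (Fin dy)))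
    (B : ℝ) (hX : ∀ x ∈ X, ‖x‖ ≤ B)
    -- bounded nonnegative loss function, Lipschitz in its first argument
    (L : Y → Y → ℝ) (hL_meas : Measurable (Function.uncurry L)) (hL_nonneg : ∀ y y', 0 ≤ L y y')
    (M : ℝ) (hM : 0 < M) (hL_bdd : ∀ y y', L y y' ≤ M)
    (Lr : ℝ) (hLr : 0 < Lr)
    (hL_lip : ∀ y' y₁ y₂ : Y, |L y₁ y' - L y₂ y'| ≤
      Lr * ‖(y₁ : EuclideanSpace ℝ (Fin dy)) - (y₂ : EuclideanSpace ℝ (Fin dy))‖)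
    -- i.i.d. samples with law `D`
    (D : Measure (X × Y)) [IsProbabilityMeasure D]
    {Ω : Type*} [MeasurableSpace Ω] (P : Measure Ω) [IsProbabilityMeasure P]
    (m : ℕ) (hm : 0 < m) (s : Fin m → Ω → X × Y) (hs_meas : ∀ i, Measurable (s i))
    (hs_indep : iIndepFun s P) (hs_law : ∀ i, P.map (s i) = D)
    (δ : ℝ) (hδ : δ ∈ Set.Ioo (0 : ℝ) 1) :
    ∃ E : Set Ω, MeasurableSet E ∧ 1 - δ ≤ P.real E ∧
      ∀ ω ∈ E, ∀ h ∈ LCNN.vectorClass n d X Y,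
        LCNN.generalizationError L D h ≤
          LCNN.empiricalError L (fun i => s i ω) h
            + Real.sqrt 2 * dy * Lr * B / Real.sqrt m * 2 ^ d
                * ∏ i ∈ Finset.Icc 1 (d - 1), ((min (n i) (n (i - 1)) : ℕ) : ℝ)
            + 3 * M * Real.sqrt (Real.log (1 / δ) / (2 * m)) := by
  -- A dense sequence requires a nonempty weight space; otherwise the class is empty.
  rcases isEmpty_or_nonempty (LCNN.vectorWeights n d X Y) with hemp | hne
  · refine ⟨Set.univ, MeasurableSet.univ, by simpa using hδ.1.le, fun ω _ h hh => ?_⟩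
    exact isEmptyElim (LCNN.exists_eq_vectorNetwork hh).choose
  have hB : 0 ≤ B := by
    obtain ⟨z⟩ := nonempty_of_isProbabilityMeasure D
    exact (norm_nonneg _).trans (hX _ z.1.2)
  have hm' : (0 : ℝ) < m := Nat.cast_pos.2 hm
  set w := ∏ i ∈ Finset.Icc 1 (d - 1), ((min (n i) (n (i - 1)) : ℕ) : ℝ)
  set R := Real.sqrt 2 * Lr * dy * (B * Real.sqrt m * 2 ^ (d - 1) * w) with hRdef
  set ρ := Real.sqrt (Real.log (1 / δ) / (2 * m)) with hρdef
  set τ := m * (3 * M * ρ) with hτdef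
  have hτ : 0 ≤ τ := by positivity
  have hlog : 0 < Real.log (1 / δ) := Real.log_pos (one_lt_one_div hδ.1 hδ.2)
  have hR2 : 2 * R / m = Real.sqrt 2 * dy * Lr * B / Real.sqrt m * 2 ^ d * w := by
    obtain ⟨e, rfl⟩ : ∃ e, d = e + 1 := ⟨d - 1, by omega⟩
    rw [hRdef, Nat.add_sub_cancel, pow_succ, div_eq_iff hm'.ne']
    have e1 : Real.sqrt 2 * dy * Lr * B / Real.sqrt m * (2 ^ e * 2) * w * m =
        Real.sqrt 2 * dy * Lr * B * (2 ^ e * 2) * w * (m / Real.sqrt m) := by ring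
    rw [e1, Real.div_sqrt]
    ring
  have hτ2 : τ / m = 3 * M * ρ := by
    rw [hτdef]
    field_simp
  -- The exponent is `9/4 * log (1 / δ)`: the constant 3 leaves room, as 2 would give `δ` exactly.
  have htail : Real.exp (-(τ ^ 2 / (2 * m * M ^ 2))) ≤ δ := by
    have hρ2 : ρ ^ 2 = Real.log (1 / δ) / (2 * m) := Real.sq_sqrt (by positivity)
    have e : τ ^ 2 / (2 * m * M ^ 2) = 9 / 4 * Real.log (1 / δ) := by
      rw [hτdef, mul_pow, mul_pow, hρ2]
      field_simp
      ring
    rw [e, ← Real.le_log_iff_exp_le hδ.1]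
    rw [one_div, Real.log_inv] at *
    linarith
  set ℓ : ℕ → X × Y → ℝ := fun j z =>
    L (LCNN.vectorNetwork (TopologicalSpace.denseSeq (LCNN.vectorWeights n d X Y) j) z.1) z.2
  have hℓ : ∀ j, Measurable (ℓ j) := fun j => LCNN.measurable_loss hL_meas _
  have hbad := LCNN.measure_exists_deviation_gt_le ℓ hℓ hM
    (fun j z => ⟨hL_nonneg _ _, hL_bdd _ _⟩) D hm
    (fun z t => LCNN.expect_loss_le hn hB hX hLr.le hL_lip z fun ε => _) hτ
  set A : Set (Fin m → X × Y) :=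
    {z | ∃ j, 2 * R + τ < ∑ i, (∫ a, ℓ j a ∂D - ℓ j (z i))} with hA
  have hAmeas : MeasurableSet A := by
    rw [hA, Set.ofPred_exists]
    exact MeasurableSet.iUnion fun j => measurableSet_lt measurable_const
      (Finset.measurable_sum _ fun i _ =>
        measurable_const.sub ((hℓ j).comp (measurable_pi_apply i)))
  have hSmeas : Measurable fun ω i => s i ω := measurable_pi_iff.2 hs_meas
  have hPA : P.real ((fun ω i => s i ω) ⁻¹' A) ≤ δ := by
    have hlaw := (iIndepFun_iff_map_fun_eq_pi_map fun i => (hs_meas i).aemeasurable).1 hs_indep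
    simp only [hs_law] at hlaw
    rw [← hlaw, Measure.map_apply hSmeas hAmeas] at hbad
    exact (ENNReal.toReal_le_of_le_ofReal (Real.exp_pos _).le hbad).trans htail
  refine ⟨((fun ω i => s i ω) ⁻¹' A)ᶜ, (hSmeas hAmeas).compl, ?_, fun ω hω h hh => ?_⟩
  · rw [probReal_compl_eq_one_sub (hSmeas hAmeas)]
    linarith
  obtain ⟨θ, rfl⟩ := LCNN.exists_eq_vectorNetwork hh
  -- The inequality is a closed condition on the weights, so it passes from the dense sequence to
  -- all of them.
  refine (TopologicalSpace.denseRange_denseSeq (LCNN.vectorWeights n d X Y)).induction_on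
    (p := fun θ => LCNN.generalizationError L D (LCNN.vectorNetwork θ) ≤
      LCNN.empiricalError L (fun i => s i ω) (LCNN.vectorNetwork θ) +
        Real.sqrt 2 * dy * Lr * B / Real.sqrt m * 2 ^ d * w + 3 * M * ρ) θ ?_ fun j => ?_
  · refine isClosed_le ?_ ?_
    · refine continuous_of_dominated (bound := fun _ => M)
        (fun θ => (LCNN.measurable_loss hL_meas θ).aestronglyMeasurable)
        (fun θ => Filter.Eventually.of_forall fun z => ?_) (integrable_const _)
        (Filter.Eventually.of_forall fun z => LCNN.continuous_loss hL_lip z)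
      rw [Real.norm_of_nonneg (hL_nonneg _ _)]
      exact hL_bdd _ _
    · exact ((continuous_const.mul (continuous_finsetSum _ fun i _ =>
        LCNN.continuous_loss hL_lip (s i ω))).add continuous_const).add continuous_const
  · have hj : ∑ i, (∫ a, ℓ j a ∂D - ℓ j (s i ω)) ≤ 2 * R + τ :=
      not_lt.1 fun hlt => hω ⟨j, hlt⟩
    rw [Finset.sum_sub_distrib, Finset.sum_const, Finset.card_univ, Fintype.card_fin,
      nsmul_eq_mul] at hj
    rw [← hR2, ← hτ2]
    change ∫ a, ℓ j a ∂D ≤ 1 / (m : ℝ) * ∑ i, ℓ j (s i ω) + 2 * R / m + τ / m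
    have e : 1 / (m : ℝ) * ∑ i, ℓ j (s i ω) + 2 * R / m + τ / m =
        (∑ i, ℓ j (s i ω) + 2 * R + τ) / m := by ring
    rw [e, le_div_iff₀ hm']
    linarith
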